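/- **Theorem 5.** *MTBNs.* A digraph $(V,E)$ (of any cardinality) is *well-founded* if it has no infinite ancestor chain $v_0\leftarrow v_1\leftarrow v_2\leftarrow\cdots$. A *measure-theoretic Bayesian network* (MTBN) consists of a well-founded digraph $(V,E)$, an arbitrary measurable space $\mathcal X_v$ for each $v\in V$, and a probability kernel $K_v$ from $\prod_{u\in \mathrm{pa}(v)}\mathcal X_u$ to $\mathcal X_v$ for each $v\in V$, where $\mathrm{pa}(v)$ is the set of parents of $v$. It *represents* a probability measure $\mu$ on $\mathcal X_V=\prod_{v\in V}\mathcal X_v$ (with coordinate projections $X_v$) if for all $v\in V$: (i) under $\mu$, $X_v$ is conditionally independent of $(X_u)_{u\in \mathrm{nd}(v)}$ given $X_{\mathrm{pa}(v)}$, where $\mathrm{nd}(v)$ is the set of vertices that cannot be reached from $v$ by a directed path of length $\ge 0$; and (ii) for every measurable $A\subseteq\mathcal X_v$, $K_v(X_{\mathrm{pa}(v)},A)=\mathbb P_\mu[X_v\in A\mid X_{\mathrm{pa}(v)}]$ $\mu$-almost surely. *BLOG models.* A measure-theoretic BLOG model $\mathcal M$ declares (at most countably many) types with (at most countably many) distinct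 constants; built-in value types with arbitrary measurable spaces; at most countably many number statements $\#\tau(g_1=x_1,\dots,g_k=x_k)\sim D$ with distinct origin functions $g_j$ from $\tau$ to the type of $x_j$; and function symbols $f(x_1,\dots,x_k)$ that are either fixed, with an interpretation $\tilde f$, or random, with a dependency statement $f(\bar x)\sim D$. A right-hand side $D$ is built from distributions $c(\bar e)$ (where $c$ specifies a probability kernel and $\bar e$ is a tuple of expressions), mixtures $\mathrm{Mix}(\{D_1\to w_1(\bar e'),\dots,D_m\to w_m(\bar e')\})$ with measurable nonnegative weights that sum to $1$ for all values of $\bar e'$, and case distinctions "if $\varphi$ then $D_1$ else $D_2$" with first-order formulas $\varphi$. Expressions and formulas are built from variables, distinct constants, function symbols, origin functions, measurable built-in operations, equality, connectives, quantifiers $\forall z{:}\tau$, $\exists z{:}\tau$, and set expressions $\{z \text{ for } \tau\ z:\varphi\}$; bound variables range over the existing objects. The *possible elements* are the distinct constants and, recursively, the elements $u_{\nu,\bar u,i}$, $i\ge1$, of type $\tau$, for every number statement $\nu$ of type $\tau$ and every tuple $\bar u$ of possible elements of the types of its arguments. The *basic random variables* $BRV(\mathcal M)$ are the number variables $V_\nu[\bar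 u]$ with space $\mathbb N$, and the variables $V_f[\bar u]$ for every random, fixed or origin function $f$, whose space consists of the values of the return type of $f$ (its possible elements with the discrete $\sigma$-algebra, or the built-in space) and an additional isolated value *null*. The element $u_{\nu,\bar u,i}$ exists under an assignment $\sigma$ if $\sigma(V_\nu[\bar u])\ge i$; constants always exist. *Its graph and kernels.* The parents of $V_s[\bar u]$ are: (a) $V_\nu[\bar v]$ for every element $u_{\nu,\bar v,i}$ that occurs in $\bar u$; (b) $V_g[\bar w]$ for every application $g(\bar t)$ that appears in the statement of $s$ and every tuple $\bar w$ that $\bar t$ can denote once $\bar u$ is substituted for the arguments $\bar x$ of $s$ and arbitrary elements $\bar u'$ of the right types are substituted for the bound variables (if $\bar t$ consists of variables, $\bar w$ is $\bar t[\bar u/\bar x][\bar u'/\bar z]$; constants and built-in, fixed and origin functions are evaluated, and a random subterm can denote anything); (c) $V_\nu[\bar v]$ for every element $u_{\nu,\bar v,i}$ that is substituted for a bound variable. The kernel $K_{V_s[\bar u]}$ evaluates the right-hand side of the statement of $s$ at $\bar u$, as a function of the values of the parents; for fixed $f$ it is the unit mass at $\tilde f(\bar u)$, and for an origin function $g$ the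 unit mass at $v_j$ if the argument is $u_{\nu,\bar v,i}$ and $g$ is the $j$-th origin function of $\nu$ (at *null* if there is no such $j$). If however an element of $\bar u$ does not exist, then the kernel is the unit mass at *null* ($0$ for a number variable). *Claim.* If the graph of $\mathcal M$ is a well-founded digraph, then the MTBN formed by $BRV(\mathcal M)$, this graph, these spaces and these kernels represents a unique probability measure $\mu$ on $\mathcal X_{BRV(\mathcal M)}$. -/

import Mathlib

open MeasureTheory ProbabilityTheory
open scoped NNReal ENNReal

/-! ## Measure-theoretic Bayesian networks -/

/-- A digraph with edge relation `E` (`E u v` is the edge `u → v`) is well-founded if there is no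
infinite ancestor chain `a 0 ← a 1 ← a 2 ← ⋯`. -/
def WellFoundedDigraph {V : Type*} (E : V → V → Prop) : Prop :=
  ¬ ∃ a : ℕ → V, ∀ n, E (a (n + 1)) (a n)

/-- A measure-theoretic Bayesian network with vertex set `V`: a well-founded digraph, a measurable
space for every vertex, and for every vertex a probability kernel from the product of the spaces
of its parents. -/
structure MTBN (V : Type*) where
  /-- `Edge u v` is the edge `u → v`. -/
  Edge : V → V → Prop
  wellFounded : WellFoundedDigraph Edge
  X : V → Type*
  [mX : ∀ v, MeasurableSpace (X v)]
  K : ∀ v, Kernel (∀ u : {u // Edge u v}, X u.1) (X v)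
  markov : ∀ v, IsMarkovKernel (K v)

attribute [instance] MTBN.mX

/-- Conditional independence of the σ-algebras `m₁`, `m₂` given `m`, through conditional
probabilities (Mathlib's `CondIndep` is restricted to standard Borel spaces; the product of the
spaces of uncountably many vertices is not of that kind). -/
def CondIndepGiven {Ω : Type*} (m m₁ m₂ : MeasurableSpace Ω) {_mΩ : MeasurableSpace Ω}
    (μ : Measure Ω) : Prop :=
  ∀ A B : Set Ω, MeasurableSet[m₁] A → MeasurableSet[m₂] B →
    μ⟦A ∩ B | m⟧ =ᵐ[μ] μ⟦A | m⟧ * μ⟦B | m⟧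

namespace MTBN

variable {V : Type*} (M : MTBN V)

/-- Parents of `v`. -/
def pa (v : V) : Set V := {u | M.Edge u v}

/-- Non-descendants of `v`: the vertices that no directed path (of length `≥ 0`) from `v`
reaches. In particular `v` is not one of them. -/
def nd (v : V) : Set V := {u | ¬ Relation.ReflTransGen M.Edge v u}

/-- The σ-algebra on the full product space that is generated by the projection `X_U` to the
coordinates in `U`. -/
@[reducible] def sigma (U : Set V) : MeasurableSpace (∀ v, M.X v) :=
  MeasurableSpace.comap (fun x (u : U) => x u.1) inferInstance

/-- `M` represents the measure `μ` on the product space: every `X_v` is conditionally independent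
of its non-descendants given its parents, and `K_v` is a version of the conditional distribution
of `X_v` given its parents. -/
def Represents (μ : Measure (∀ v, M.X v)) : Prop :=
  ∀ v : V,
    CondIndepGiven (M.sigma (M.pa v)) (M.sigma {v}) (M.sigma (M.nd v)) μ ∧
    ∀ A : Set (M.X v), MeasurableSet A →
      (fun x => (M.K v (fun u => x u.1) A).toReal) =ᵐ[μ]
        μ⟦(fun x : ∀ v, M.X v => x v) ⁻¹' A | M.sigma (M.pa v)⟧

end MTBN

/-! ## Measure-theoretic BLOG: vocabulary, possible elements, values -/

namespace BLOG

/-- The vocabulary of a BLOG model. -/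
structure Vocab where
  /-- Types whose elements are the distinct constants and the objects generated by number
  statements (user types; also for instance time steps, with constants `0, 1, 2, …`). -/
  Ty : Type
  /-- Built-in value types, such as `Real` or `Bool`, with an arbitrary measurable space. -/
  BTy : Type
  carrier : BTy → Type
  [mcarrier : ∀ b, MeasurableSpace (carrier b)]
  /-- The distinct constants of each type. -/
  Const : Ty → Type
  /-- Origin functions `origin (orgCod g) g (orgDom g)`. -/
  Org : Type
  orgDom : Org → Ty
  orgCod : Org → Ty
  /-- Number statements `#(numTy ν)(g₁ = x₁, …, g_k = x_k)`. The type of `x_j` is the return type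
  of the origin function `g_j = numOrg ν j`. -/
  Num : Type
  numTy : Num → Ty
  numArity : Num → ℕ
  numOrg : ∀ ν, Fin (numArity ν) → Org
  numOrg_dom : ∀ ν j, orgDom (numOrg ν j) = numTy ν
  numOrg_injective : ∀ ν, Function.Injective (numOrg ν)
  /-- Random and fixed function symbols, with their argument types and their return type, which
  is either in `Ty` or built-in. -/
  Fn : Type
  fnArity : Fn → ℕ
  fnArg : ∀ f, Fin (fnArity f) → Ty
  fnRet : Fn → Ty ⊕ BTy
  [countable_Ty : Countable Ty]
  [countable_Const : ∀ τ, Countable (Const τ)]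
  [countable_Num : Countable Num]

attribute [instance] Vocab.mcarrier Vocab.countable_Ty Vocab.countable_Const Vocab.countable_Num

namespace Vocab

variable (S : Vocab)

/-- The type of the `j`-th argument of a number statement. -/
def numArg (ν : S.Num) (j : Fin (S.numArity ν)) : S.Ty := S.orgCod (S.numOrg ν j)

/-- The possible elements of each type: the distinct constants, and the elements
`gen ν u i`, where `ν` is a number statement of that type, `u` a tuple of possible elements of the
types of its arguments, and `i : ℕ`. Indices start at `0`: `gen ν u i` is the `(i+1)`-st object
that `ν` generates for `u`. -/
inductive Elem : S.Ty → Type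
  | con {τ : S.Ty} (c : S.Const τ) : Elem τ
  | gen (ν : S.Num) (u : ∀ j : Fin (S.numArity ν), Elem (S.numArg ν j)) (i : ℕ) :
      Elem (S.numTy ν)

variable {S}

/-- Auxiliary: shapes of elements, used only for countability. -/
abbrev Shape (S : Vocab) : Type := (Σ τ, S.Const τ) ⊕ (S.Num × ℕ)

/-- Auxiliary: arity of a shape. -/
def Shape.arity : Shape S → ℕ
  | .inl _ => 0
  | .inr p => S.numArity p.1

/-- Auxiliary: the tree of an element. -/
def Elem.tree : ∀ {τ : S.Ty}, S.Elem τ → WType (fun a : Shape S => Fin a.arity)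
  | τ, .con c => ⟨.inl ⟨τ, c⟩, fun j => j.elim0⟩
  | _, .gen ν u i => ⟨.inr (ν, i), fun j => (u j).tree⟩

theorem Elem.tree_inj {τ τ₁ : S.Ty} (a : S.Elem τ) (b : S.Elem τ₁) (h : a.tree = b.tree) :
    τ = τ₁ ∧ a ≍ b := by
  induction a generalizing τ₁ with
  | con c =>
    cases b with
    | con c₁ =>
      simp only [Elem.tree, WType.mk.injEq, Sum.inl.injEq] at h
      obtain ⟨h, -⟩ := h
      cases h
      exact ⟨rfl, HEq.rfl⟩
    | gen => simp [Elem.tree] at h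
  | gen ν u i ih =>
    cases b with
    | con c₁ => simp [Elem.tree] at h
    | gen ν₁ u₁ i₁ =>
      simp only [Elem.tree, WType.mk.injEq, Sum.inr.injEq, Prod.mk.injEq] at h
      obtain ⟨⟨rfl, rfl⟩, h⟩ := h
      have h := eq_of_heq h
      have : u = u₁ := funext fun j => eq_of_heq (ih j (u₁ j) (congrFun h j)).2
      subst this
      exact ⟨rfl, HEq.rfl⟩

instance (τ : S.Ty) : Countable (S.Elem τ) := by
  have : Encodable (Shape S) := Encodable.ofCountable _
  exact Function.Injective.countable (f := Elem.tree)
    fun a b h => eq_of_heq (Elem.tree_inj a b h).2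

/-- The value of the origin function `g` on an element: `g_j (gen ν u i) = u_j` if `g_j` is the
`j`-th origin function of `ν`; `null` (`none`) if `g` was not used in the generation of the
element. -/
noncomputable def Elem.origin (g : S.Org) : ∀ {τ : S.Ty}, S.Elem τ → Option (S.Elem (S.orgCod g))
  | _, .con _ => none
  | _, .gen ν u _ =>
    open Classical in
    if h : ∃ j, S.numOrg ν j = g then some (h.choose_spec ▸ u h.choose) else none

variable (S) in
/-- The values of a type: its possible elements, or the points of the built-in space, and
additionally the special value `null`, which is `none`. -/
def TVal : S.Ty ⊕ S.BTy → Type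
  | .inl τ => Option (S.Elem τ)
  | .inr b => Option (S.carrier b)

/-- The value `null`. -/
def null : ∀ t, S.TVal t
  | .inl _ => none
  | .inr _ => none

/-- Possible elements form a (countable) discrete space; `null` is an isolated point that is added
to the space of a built-in type. -/
instance : ∀ t, MeasurableSpace (S.TVal t)
  | .inl _ => ⊤
  | .inr _ => MeasurableSpace.map some inferInstance

variable (S) in
/-- Sorts of expressions: a type, truth values, or sets of elements of a type. -/
inductive Srt : Type
  | ty (t : S.Ty ⊕ S.BTy)
  | prop
  | set (τ : S.Ty)

/-- Expressions of a type in `Ty`. -/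
abbrev Srt.obj (τ : S.Ty) : S.Srt := .ty (.inl τ)

variable (S) in
/-- The values of each sort. -/
def Val : S.Srt → Type
  | .ty t => S.TVal t
  | .prop => Prop
  | .set τ => Set (S.Elem τ)

instance : ∀ s, MeasurableSpace (S.Val s)
  | .ty t => inferInstanceAs (MeasurableSpace (S.TVal t))
  | .prop => inferInstanceAs (MeasurableSpace Prop)
  | .set τ => inferInstanceAs (MeasurableSpace (Set (S.Elem τ)))

instance (τ : S.Ty) : Countable (S.Val (Srt.obj τ)) := inferInstanceAs (Countable (Option _))
instance (τ : S.Ty) : DiscreteMeasurableSpace (S.Val (Srt.obj τ)) := ⟨fun _ => trivial⟩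

/-! ### Expressions and statements -/

/-- Expressions with free logical variables `x_0, …, x_{n-1}` of the types `Γ 0, …, Γ (n-1)`
(de Bruijn style: a binder adds a new variable `0`). Expressions of sort `prop` are the
first-order formulas. -/
inductive Expr (S : Vocab) : (n : ℕ) → (Fin n → S.Ty) → S.Srt → Type
  /-- a logical variable -/
  | var {n : ℕ} {Γ : Fin n → S.Ty} (i : Fin n) : Expr S n Γ (Srt.obj (Γ i))
  /-- a distinct constant -/
  | con {n : ℕ} {Γ : Fin n → S.Ty} {τ : S.Ty} (c : S.Const τ) : Expr S n Γ (Srt.obj τ)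
  /-- application of a random or fixed function symbol -/
  | app {n : ℕ} {Γ : Fin n → S.Ty} (f : S.Fn)
      (e : ∀ j : Fin (S.fnArity f), Expr S n Γ (Srt.obj (S.fnArg f j))) :
      Expr S n Γ (.ty (S.fnRet f))
  /-- application of an origin function -/
  | org {n : ℕ} {Γ : Fin n → S.Ty} (g : S.Org) (e : Expr S n Γ (Srt.obj (S.orgDom g))) :
      Expr S n Γ (Srt.obj (S.orgCod g))
  /-- a built-in deterministic (measurable) operation or relation on values, such as `+`, `<`,
  literals (no arguments), the predecessor of a time step, or the cardinality of a set -/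
  | op {n : ℕ} {Γ : Fin n → S.Ty} {k : ℕ} {s : Fin k → S.Srt} {r : S.Srt}
      (h : (∀ j, S.Val (s j)) → S.Val r) (hm : Measurable h) (e : ∀ j, Expr S n Γ (s j)) :
      Expr S n Γ r
  /-- equality of elements -/
  | eq {n : ℕ} {Γ : Fin n → S.Ty} {τ : S.Ty} (a b : Expr S n Γ (Srt.obj τ)) : Expr S n Γ .prop
  | not {n : ℕ} {Γ : Fin n → S.Ty} (φ : Expr S n Γ .prop) : Expr S n Γ .prop
  | and {n : ℕ} {Γ : Fin n → S.Ty} (φ ψ : Expr S n Γ .prop) : Expr S n Γ .prop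
  /-- `∀ z : τ, φ`, where `z` ranges over the objects of type `τ` that exist -/
  | all {n : ℕ} {Γ : Fin n → S.Ty} (τ : S.Ty)
      (φ : Expr S (n + 1) (Fin.cons τ Γ : Fin (n + 1) → S.Ty) .prop) : Expr S n Γ .prop
  /-- `∃ z : τ, φ`, where `z` ranges over the objects of type `τ` that exist -/
  | ex {n : ℕ} {Γ : Fin n → S.Ty} (τ : S.Ty)
      (φ : Expr S (n + 1) (Fin.cons τ Γ : Fin (n + 1) → S.Ty) .prop) : Expr S n Γ .prop
  /-- the set `{z for τ z : φ}` of the objects of type `τ` that exist and satisfy `φ` -/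
  | setOf {n : ℕ} {Γ : Fin n → S.Ty} (τ : S.Ty)
      (φ : Expr S (n + 1) (Fin.cons τ Γ : Fin (n + 1) → S.Ty) .prop) : Expr S n Γ (.set τ)

/-- The right-hand side of a dependency or number statement with values in `R`. -/
inductive Stmt (S : Vocab) (n : ℕ) (Γ : Fin n → S.Ty) (R : Type) [MeasurableSpace R] : Type
  /-- `c(e₁, …, e_k)`, where the distribution `c` specifies the probability kernel `κ` -/
  | dist {k : ℕ} {s : Fin k → S.Srt} (κ : Kernel (∀ j, S.Val (s j)) R) (hκ : IsMarkovKernel κ)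
      (e : ∀ j, Expr S n Γ (s j)) : Stmt S n Γ R
  /-- `Mix({D_1 → w_1(e), …, D_m → w_m(e)})`, with weights that sum to `1` for all values of `e` -/
  | mix {m k : ℕ} {s : Fin k → S.Srt} (w : Fin m → (∀ j, S.Val (s j)) → ℝ≥0)
      (hw : ∀ i, Measurable (w i)) (hsum : ∀ x, ∑ i, w i x = 1)
      (e : ∀ j, Expr S n Γ (s j)) (D : Fin m → Stmt S n Γ R) : Stmt S n Γ R
  /-- `if φ then D₁ else D₂` -/
  | ite (φ : Expr S n Γ .prop) (D₁ D₂ : Stmt S n Γ R) : Stmt S n Γ R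

end Vocab

/-- How a function symbol is declared: `random`, with a dependency statement whose free variables
are the arguments of the function, or `fixed`, with an interpretation. -/
inductive Decl (S : Vocab) (f : S.Fn) : Type
  | random (s : S.Stmt (S.fnArity f) (S.fnArg f) (S.TVal (S.fnRet f)))
  | fixed (F : (∀ j, S.Elem (S.fnArg f j)) → S.TVal (S.fnRet f))

/-- A measure-theoretic BLOG model (observations and queries play no role in its prior). -/
structure Model extends Vocab where
  decl : ∀ f, Decl toVocab f
  numStmt : ∀ ν, toVocab.Stmt (toVocab.numArity ν) (toVocab.numArg ν) ℕ

/-! ### Basic random variables -/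

/-- The basic random variables: number variables `V_ν[u]`, and function application variables
`V_f[u]` for random, fixed and origin functions. -/
inductive BRV (S : Vocab) : Type
  | num (ν : S.Num) (u : ∀ j, S.Elem (S.numArg ν j))
  | fn (f : S.Fn) (u : ∀ j, S.Elem (S.fnArg f j))
  | org (g : S.Org) (u : S.Elem (S.orgDom g))

namespace BRV

variable {S : Vocab}

/-- The space of a basic random variable. -/
def Space : BRV S → Type
  | .num _ _ => ℕ
  | .fn f _ => S.TVal (S.fnRet f)
  | .org g _ => S.TVal (.inl (S.orgCod g))

instance : ∀ v : BRV S, MeasurableSpace v.Space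
  | .num _ _ => inferInstanceAs (MeasurableSpace ℕ)
  | .fn f _ => inferInstanceAs (MeasurableSpace (S.TVal (S.fnRet f)))
  | .org g _ => inferInstanceAs (MeasurableSpace (S.TVal (.inl (S.orgCod g))))

/-- The value that says that nothing is there: `0` for number variables, `null` for the others. -/
def default : ∀ v : BRV S, v.Space
  | .num _ _ => (0 : ℕ)
  | .fn f _ => S.null (S.fnRet f)
  | .org g _ => S.null (.inl (S.orgCod g))

end BRV

/-- Instantiations of all basic random variables. -/
abbrev Inst (S : Vocab) : Type := ∀ v : BRV S, v.Space

namespace Vocab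

variable {S : Vocab}

/-- The number variables on which the existence of an element depends: the variable `V_ν[u]` for
the element `gen ν u i`, none for a constant. -/
def Elem.numVars : ∀ {τ : S.Ty}, S.Elem τ → Set (BRV S)
  | _, .con _ => ∅
  | _, .gen ν u _ => {.num ν u}

/-- Whether an element exists under `σ`: `gen ν u i` does if `σ (V_ν[u]) ≥ i + 1`. -/
def Elem.Exists (σ : Inst S) : ∀ {τ : S.Ty}, S.Elem τ → Prop
  | _, .con _ => True
  | _, .gen ν u i => i < (σ (.num ν u) : ℕ)

/-- Extension of an assignment of elements to logical variables. -/
def push {n : ℕ} {Γ : Fin n → S.Ty} {τ : S.Ty} (z : S.Elem τ) (ρ : ∀ i, S.Elem (Γ i)) :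
    ∀ i, S.Elem ((Fin.cons τ Γ : Fin (n + 1) → S.Ty) i) :=
  Fin.cons (α := fun i => S.Elem ((Fin.cons τ Γ : Fin (n + 1) → S.Ty) i)) z ρ

open Classical in
/-- Value of a function on arguments that may be `null`; the result is `null` if one of them is. -/
noncomputable def strict {k : ℕ} {τ : Fin k → S.Ty} {t : S.Ty ⊕ S.BTy}
    (F : (∀ j, S.Elem (τ j)) → S.TVal t) (x : ∀ j, S.Val (Srt.obj (τ j))) : S.TVal t :=
  if h : ∃ w : ∀ j, S.Elem (τ j), ∀ j, x j = some (w j) then F h.choose else S.null t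

/-- The value of an expression in terms of the values `σ` of the basic random variables, with the
elements `ρ` substituted for the free variables. -/
noncomputable def Expr.eval (σ : Inst S) :
    ∀ {n : ℕ} {Γ : Fin n → S.Ty} {s : S.Srt}, S.Expr n Γ s → (∀ i, S.Elem (Γ i)) → S.Val s
  | _, _, _, .var i, ρ => some (ρ i)
  | _, _, _, .con c, _ => some (Elem.con c)
  | _, _, _, .app f e, ρ => strict (fun w => σ (.fn f w)) fun j => (e j).eval σ ρ
  | _, _, _, .org g e, ρ =>
    strict (k := 1) (τ := fun _ => S.orgDom g) (t := .inl (S.orgCod g))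
      (fun w => σ (.org g (w 0))) fun _ => e.eval σ ρ
  | _, _, _, .op h _ e, ρ => h fun j => (e j).eval σ ρ
  | _, _, _, .eq a b, ρ => a.eval σ ρ = b.eval σ ρ
  | _, _, _, .not φ, ρ => ¬ (φ.eval σ ρ : Prop)
  | _, _, _, .and φ ψ, ρ => (φ.eval σ ρ : Prop) ∧ (ψ.eval σ ρ : Prop)
  | _, _, _, .all τ φ, ρ =>
    ∀ z : S.Elem τ, z.Exists σ → (φ.eval σ (push z ρ) : Prop)
  | _, _, _, .ex τ φ, ρ =>
    ∃ z : S.Elem τ, z.Exists σ ∧ (φ.eval σ (push z ρ) : Prop)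
  | _, _, _, .setOf τ φ, ρ =>
    {z : S.Elem τ | z.Exists σ ∧ (φ.eval σ (push z ρ) : Prop)}

theorem Elem.measurable_exists {τ : S.Ty} (z : S.Elem τ) :
    Measurable fun σ : Inst S => z.Exists σ := by
  cases z with
  | con c => exact measurable_const
  | gen ν u i =>
    have h : Measurable fun σ : Inst S => (σ (.num ν u) : ℕ) :=
      measurable_pi_apply (BRV.num ν u)
    exact (measurable_from_top (f := fun m : ℕ => i < m)).comp h

theorem measurable_strict {k : ℕ} {τ : Fin k → S.Ty} {t : S.Ty ⊕ S.BTy}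
    {F : Inst S → (∀ j, S.Elem (τ j)) → S.TVal t} (hF : ∀ w, Measurable fun σ => F σ w)
    {x : Inst S → ∀ j, S.Val (Srt.obj (τ j))} (hx : ∀ j, Measurable fun σ => x σ j) :
    Measurable fun σ => strict (F σ) (x σ) := by
  have h : Measurable fun p : Inst S × (∀ j, S.Val (Srt.obj (τ j))) => strict (F p.1) p.2 := by
    apply measurable_from_prod_countable_left
    intro y
    unfold strict
    by_cases h : ∃ w : ∀ j, S.Elem (τ j), ∀ j, y j = some (w j)
    · simpa only [dif_pos h] using hF _
    · simpa only [dif_neg h] using measurable_const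
  exact h.comp (measurable_id.prodMk (measurable_pi_lambda _ hx))

theorem Expr.measurable_eval {n : ℕ} {Γ : Fin n → S.Ty} {s : S.Srt} (e : S.Expr n Γ s)
    (ρ : ∀ i, S.Elem (Γ i)) : Measurable fun σ : Inst S => e.eval σ ρ := by
  induction e with
  | var i => exact measurable_const
  | con c => exact measurable_const
  | app f e ih => exact measurable_strict (fun w => measurable_pi_apply _) fun j => ih j ρ
  | org g e ih => exact measurable_strict (fun w => measurable_pi_apply _) fun _ => ih ρ
  | op h hm e ih => exact hm.comp (measurable_pi_lambda _ fun j => ih j ρ)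
  | @eq n Γ τ a b iha ihb =>
    exact (measurable_of_countable
      (fun p : S.Val (Srt.obj τ) × S.Val (Srt.obj τ) => p.1 = p.2)).comp
      ((iha ρ).prodMk (ihb ρ))
  | not φ ih => exact Measurable.not (ih ρ)
  | and φ ψ ihφ ihψ => exact Measurable.and (ihφ ρ) (ihψ ρ)
  | all τ φ ih => exact Measurable.forall fun z => z.measurable_exists.imp (ih _)
  | ex τ φ ih => exact Measurable.exists fun z => z.measurable_exists.and (ih _)
  | setOf τ φ ih => exact measurable_pi_lambda _ fun z => z.measurable_exists.and (ih _)

open Classical in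
/-- The kernel of a statement, from the values of the basic random variables, after substitution
of the elements `ρ` for the free variables. -/
noncomputable def Stmt.kernel {n : ℕ} {Γ : Fin n → S.Ty} {R : Type} [MeasurableSpace R]
    (ρ : ∀ i, S.Elem (Γ i)) : S.Stmt n Γ R → Kernel (Inst S) R
  | .dist κ _ e =>
    κ.comap (fun σ j => (e j).eval σ ρ) (measurable_pi_lambda _ fun j => (e j).measurable_eval ρ)
  | .mix w hw _ e D =>
    { toFun := fun σ => ∑ i, (w i fun j => (e j).eval σ ρ) • (D i).kernel ρ σ
      measurable' := by
        refine Measure.measurable_of_measurable_coe _ fun A hA => ?_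
        simp only [Measure.coe_finsetSum, Measure.coe_nnreal_smul_apply, Finset.sum_apply]
        refine Finset.measurable_sum _ fun i _ => Measurable.mul ?_ ?_
        · exact measurable_coe_nnreal_ennreal.comp ((hw i).comp
            (measurable_pi_lambda _ fun j => (e j).measurable_eval ρ))
        · exact ((D i).kernel ρ).measurable_coe hA }
  | .ite φ D₁ D₂ =>
    Kernel.piecewise (s := {σ | φ.eval σ ρ}) (measurableSet_setOfPred.2 (φ.measurable_eval ρ))
      (D₁.kernel ρ) (D₂.kernel ρ)

theorem Stmt.isMarkovKernel {n : ℕ} {Γ : Fin n → S.Ty} {R : Type} [MeasurableSpace R]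
    (ρ : ∀ i, S.Elem (Γ i)) (D : S.Stmt n Γ R) : IsMarkovKernel (D.kernel ρ) := by
  induction D with
  | dist κ hκ e => unfold Stmt.kernel; infer_instance
  | mix w hw hsum e D ih =>
    refine ⟨fun σ => ⟨?_⟩⟩
    change (∑ i, (w i fun j => (e j).eval σ ρ) • (D i).kernel ρ σ) Set.univ = 1
    simp only [Measure.coe_finsetSum, Measure.coe_nnreal_smul_apply, Finset.sum_apply,
      measure_univ, mul_one]
    rw [← ENNReal.ofNNReal_finsetSum, hsum, ENNReal.coe_one]
  | ite φ D₁ D₂ ih₁ ih₂ => unfold Stmt.kernel; infer_instance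

end Vocab

/-! ### Edges -/

namespace Model

variable (M : Model)

open Vocab

/-- The values that an expression can take once the elements `ρ` are substituted for its free
variables, as far as they are determined independently of the random functions: a variable, a
constant, and whatever is computed from these by built-in, fixed or origin functions (which also
may be `null`) have a known value. -/
def poss : ∀ {n : ℕ} {Γ : Fin n → M.Ty} {s : M.Srt},
    M.Expr n Γ s → (∀ i, M.Elem (Γ i)) → Set (M.Val s)
  | _, _, _, .var i, ρ => {y | y = some (ρ i)}
  | _, _, _, .con c, _ => {y | y = some (Elem.con c)}
  | _, _, _, .app f e, ρ =>
    match M.decl f with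
    | .random _ => Set.univ
    | .fixed F => {y | y = M.null _ ∨
        ∃ w : ∀ j, M.Elem (M.fnArg f j), (∀ j, some (w j) ∈ poss (e j) ρ) ∧ y = F w}
  | _, _, _, .org g e, ρ =>
    {y | y = none ∨ ∃ w : M.Elem (M.orgDom g), some w ∈ poss e ρ ∧ y = w.origin g}
  | _, _, _, .op h _ e, ρ => {y | ∃ x, (∀ j, x j ∈ poss (e j) ρ) ∧ y = h x}
  | _, _, _, _, _ => Set.univ

/-- The basic random variables that determine the value of an expression, with the elements `ρ`
substituted for the free variables. The application `g(e₁, …, e_k)` contributes the variables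
`V_g[w]` for all possible values `w` of the arguments; when these are logical variables, `w` is
the tuple of the elements substituted for them. For a bound variable, every element of its type is
substituted; the number variables that decide whether that element exists are included. -/
def deps : ∀ {n : ℕ} {Γ : Fin n → M.Ty} {s : M.Srt},
    M.Expr n Γ s → (∀ i, M.Elem (Γ i)) → Set (BRV M.toVocab)
  | _, _, _, .var _, _ => ∅
  | _, _, _, .con _, _ => ∅
  | _, _, _, .app f e, ρ =>
    {v | ∃ w, (∀ j, some (w j) ∈ M.poss (e j) ρ) ∧ v = .fn f w} ∪ ⋃ j, deps (e j) ρ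
  | _, _, _, .org g e, ρ => {v | ∃ w, some w ∈ poss M e ρ ∧ v = .org g w} ∪ deps e ρ
  | _, _, _, .op _ _ e, ρ => ⋃ j, deps (e j) ρ
  | _, _, _, .eq a b, ρ => deps a ρ ∪ deps b ρ
  | _, _, _, .not φ, ρ => deps φ ρ
  | _, _, _, .and φ ψ, ρ => deps φ ρ ∪ deps ψ ρ
  | _, _, _, .all τ φ, ρ => ⋃ z : M.Elem τ, z.numVars ∪ deps φ (push z ρ)
  | _, _, _, .ex τ φ, ρ => ⋃ z : M.Elem τ, z.numVars ∪ deps φ (push z ρ)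
  | _, _, _, .setOf τ φ, ρ => ⋃ z : M.Elem τ, z.numVars ∪ deps φ (push z ρ)

/-- The basic random variables that determine the values of the expressions in a statement. -/
def stmtDeps {n : ℕ} {Γ : Fin n → M.Ty} {R : Type} [MeasurableSpace R] (ρ : ∀ i, M.Elem (Γ i)) :
    M.Stmt n Γ R → Set (BRV M.toVocab)
  | .dist _ _ e => ⋃ j, M.deps (e j) ρ
  | .mix _ _ _ e D => (⋃ j, M.deps (e j) ρ) ∪ ⋃ i, stmtDeps ρ (D i)
  | .ite φ D₁ D₂ => M.deps φ ρ ∪ stmtDeps ρ D₁ ∪ stmtDeps ρ D₂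

/-- The basic random variables that determine the values of the expressions in the declaration of
a function symbol. -/
def declDeps {f : M.Fn} (u : ∀ j, M.Elem (M.fnArg f j)) :
    Decl M.toVocab f → Set (BRV M.toVocab)
  | .random s => M.stmtDeps u s
  | .fixed _ => ∅

/-- The parents of a basic random variable `V_s[u]`: the number variables of the elements in `u`,
and the variables that determine the expressions in the statement of `s`. -/
def parents : BRV M.toVocab → Set (BRV M.toVocab)
  | .num ν u => (⋃ j, (u j).numVars) ∪ M.stmtDeps u (M.numStmt ν)
  | .fn f u => (⋃ j, (u j).numVars) ∪ M.declDeps u (M.decl f)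
  | .org _ u => u.numVars

/-- The edges `v → w` between basic random variables. -/
def Edge (v w : BRV M.toVocab) : Prop := v ∈ M.parents w

/-! ### Kernels -/

/-- All elements in the index of a basic random variable exist under `σ`. -/
def ArgsExist (σ : Inst M.toVocab) : BRV M.toVocab → Prop
  | .num _ u => ∀ j, (u j).Exists σ
  | .fn _ u => ∀ j, (u j).Exists σ
  | .org _ u => u.Exists σ

theorem measurable_argsExist (v : BRV M.toVocab) :
    Measurable fun σ : Inst M.toVocab => M.ArgsExist σ v := by
  cases v with
  | num ν u => exact Measurable.forall fun j => (u j).measurable_exists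
  | fn f u => exact Measurable.forall fun j => (u j).measurable_exists
  | org g u => exact u.measurable_exists

/-- The kernel of the declaration of a function symbol; a fixed function takes the value of its
interpretation. -/
noncomputable def declKernel {S : Vocab} {f : S.Fn} (u : ∀ j, S.Elem (S.fnArg f j)) :
    Decl S f → Kernel (Inst S) (S.TVal (S.fnRet f))
  | .random s => s.kernel u
  | .fixed F => Kernel.const _ (Measure.dirac (F u))

/-- The kernel of the statement of a basic random variable, in terms of all basic random variables
and without regard to the existence of the arguments. Origin functions are the inverse maps of the generation of objects. -/
noncomputable def bodyKernel : ∀ v : BRV M.toVocab, Kernel (Inst M.toVocab) v.Space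
  | .num ν u => (M.numStmt ν).kernel u
  | .fn f u => declKernel u (M.decl f)
  | .org g u => Kernel.const _ (Measure.dirac (u.origin g : M.TVal (.inl (M.orgCod g))))

theorem isMarkovKernel_bodyKernel (v : BRV M.toVocab) : IsMarkovKernel (M.bodyKernel v) := by
  have hdirac {R : Type} [MeasurableSpace R] (r : R) :
      IsMarkovKernel (Kernel.const (Inst M.toVocab) (Measure.dirac r)) := inferInstance
  cases v with
  | num ν u => exact Stmt.isMarkovKernel u _
  | fn f u =>
    change IsMarkovKernel (declKernel u (M.decl f))
    cases M.decl f with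
    | random s => exact s.isMarkovKernel u
    | fixed F => exact hdirac (R := M.TVal _) _
  | org g u => exact hdirac (R := M.TVal (.inl (M.orgCod g))) _

open Classical in
/-- The locally consistent kernel of a basic random variable in terms of all basic random
variables: if an element of its index does not exist, the value is `null` (`0` for a number
variable). -/
noncomputable def fullKernel (v : BRV M.toVocab) : Kernel (Inst M.toVocab) v.Space :=
  Kernel.piecewise (s := {σ | M.ArgsExist σ v})
    (measurableSet_setOfPred.2 (M.measurable_argsExist v))
    (M.bodyKernel v) (Kernel.const _ (Measure.dirac v.default))

open Classical in
/-- The instantiation that agrees with `x` on the parents of `v` and has default values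
elsewhere. -/
noncomputable def fill (v : BRV M.toVocab) (x : ∀ u : {u // M.Edge u v}, u.1.Space) :
    Inst M.toVocab :=
  fun u => if h : M.Edge u v then x ⟨u, h⟩ else u.default

theorem measurable_fill (v : BRV M.toVocab) : Measurable (M.fill v) := by
  refine measurable_pi_lambda _ fun u => ?_
  by_cases h : M.Edge u v
  · simpa [fill, h] using measurable_pi_apply (⟨u, h⟩ : {u // M.Edge u v})
  · simp [fill, h]

/-- The kernel of a basic random variable from its parents: the kernel of its statement, read as a
function of the values of the parents. (The default values in `fill` are never looked up when the
fixed and origin functions among the parents have their prescribed values or `null`, which holds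
almost surely.) -/
noncomputable def paKernel (v : BRV M.toVocab) :
    Kernel (∀ u : {u // M.Edge u v}, u.1.Space) v.Space :=
  (M.fullKernel v).comap (M.fill v) (M.measurable_fill v)

theorem isMarkovKernel_paKernel (v : BRV M.toVocab) : IsMarkovKernel (M.paKernel v) := by
  have := M.isMarkovKernel_bodyKernel v
  unfold paKernel fullKernel
  infer_instance

/-- The MTBN of a BLOG model with a well-founded graph. -/
noncomputable def toMTBN (h : WellFoundedDigraph M.Edge) : MTBN (BRV M.toVocab) where
  Edge := M.Edge
  wellFounded := h
  X := BRV.Space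
  K := M.paKernel
  markov := M.isMarkovKernel_paKernel

end Model

end BLOG

/-!
Extend the edge relation to a well-order of the vertices. A law that keeps the coordinates outside
`I` and draws each coordinate `v ∈ I` from its kernel, given the past of `v`, is unique by
transfinite induction, since finite cylinders can be split at their largest coordinate.

Such laws exist by transfinite recursion on the order. A successor step draws one more coordinate.
At a limit of countable cofinality, the Ionescu-Tulcea theorem yields a Markov chain of points
whose steps resample successive blocks of coordinates; every coordinate settles eventually, and the
settled point has the required law. At any other limit each event already belongs to an earlier
stage, so the earlier laws glue. Once all coordinates have been resampled, the starting point is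
forgotten.

A network represents `μ` if and only if each kernel is the conditional law of its vertex given all
non-descendants. These include the past of the vertex in the order, which gives uniqueness; the
existence half needs the converse passage, from the past to the non-descendants, some of which may
come later in the order.
-/

section AgreeOn

variable {Ω : Type*} {m m' mΩ : MeasurableSpace Ω} {μ ν ξ : Measure Ω}

/-- Two measures agree on the events of `m`. Unlike equality of `Measure.trim`s, this can be
stated without a proof of `m ≤ mΩ`. -/
def AgreeOn (m : MeasurableSpace Ω) {_mΩ : MeasurableSpace Ω} (μ ν : Measure Ω) : Prop :=
  ∀ C, MeasurableSet[m] C → μ C = ν C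

theorem AgreeOn.symm (h : AgreeOn m μ ν) : AgreeOn m ν μ := fun C hC => (h C hC).symm

theorem AgreeOn.trans (h : AgreeOn m μ ν) (h' : AgreeOn m ν ξ) : AgreeOn m μ ξ :=
  fun C hC => (h C hC).trans (h' C hC)

theorem AgreeOn.mono (h : AgreeOn m' μ ν) (hm : m ≤ m') : AgreeOn m μ ν := fun C hC => h C (hm C hC)

theorem AgreeOn.lintegral_eq (h : AgreeOn m μ ν) (hm : m ≤ mΩ) {f : Ω → ℝ≥0∞}
    (hf : Measurable[m] f) : ∫⁻ y, f y ∂μ = ∫⁻ y, f y ∂ν := by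
  have htrim : μ.trim hm = ν.trim hm := by
    refine @Measure.ext _ m _ _ fun C hC => ?_
    rw [trim_measurableSet_eq hm hC, trim_measurableSet_eq hm hC, h C hC]
  rw [← lintegral_trim hm hf, htrim, lintegral_trim hm hf]

theorem AgreeOn.setLIntegral_eq (h : AgreeOn m μ ν) (hm : m ≤ mΩ) {f : Ω → ℝ≥0∞}
    (hf : Measurable[m] f) {C : Set Ω} (hC : MeasurableSet[m] C) :
    ∫⁻ y in C, f y ∂μ = ∫⁻ y in C, f y ∂ν := by
  rw [← lintegral_indicator (hm C hC), ← lintegral_indicator (hm C hC)]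
  exact h.lintegral_eq hm (hf.indicator hC)

theorem agreeOn_dirac_iff [IsProbabilityMeasure μ] (hm : m ≤ mΩ) {x : Ω} :
    AgreeOn m μ (Measure.dirac x) ↔ ∀ C, MeasurableSet[m] C → ∀ᵐ y ∂μ, y ∈ C ↔ x ∈ C := by
  refine ⟨fun h C hC => ?_, fun h C hC => ?_⟩
  · have hmem : ∀ D, MeasurableSet[m] D → x ∈ D → ∀ᵐ y ∂μ, y ∈ D := fun D hD hx =>
      (mem_ae_iff_prob_eq_one (hm D hD)).2 <| by
        rw [h D hD, Measure.dirac_apply' x (hm D hD), Set.indicator_of_mem hx, Pi.one_apply]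
    by_cases hx : x ∈ C
    · filter_upwards [hmem C hC hx] with y hy using iff_of_true hy hx
    · filter_upwards [hmem Cᶜ hC.compl hx] with y hy using iff_of_false hy hx
  · have hCx : (C : Set Ω) =ᵐ[μ] {_y | x ∈ C} := Filter.eventuallyEq_set.2 (h C hC)
    rw [Measure.dirac_apply' x (hm C hC), measure_congr hCx]
    by_cases hx : x ∈ C <;> simp [hx]

theorem AgreeOn.measure_inter_of_dirac [IsProbabilityMeasure μ] (hm : m ≤ mΩ) {x : Ω}
    (h : AgreeOn m μ (Measure.dirac x)) (A : Set Ω) {C : Set Ω} (hC : MeasurableSet[m] C) :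
    μ (A ∩ C) = C.indicator (fun _ => μ A) x := by
  have hCx : (A ∩ C : Set Ω) =ᵐ[μ] {y | y ∈ A ∧ x ∈ C} := by
    filter_upwards [(agreeOn_dirac_iff hm).1 h C hC] with y hy
    exact propext (and_congr_right fun _ => hy)
  rw [measure_congr hCx]
  by_cases hx : x ∈ C <;> simp [hx]

end AgreeOn

section HasCondLaw

variable {Ω E : Type*} {m m' mΩ : MeasurableSpace Ω} [MeasurableSpace E] {Y : Ω → E}
  {κ : Kernel Ω E} {μ ν : Measure Ω}

/-- `κ` is the conditional law of the random variable `Y` given the σ-algebra `m`, under `ν`. That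
`κ` depends only on the information in `m` is a separate hypothesis `Measurable[m] κ`. -/
def HasCondLaw (m : MeasurableSpace Ω) {_mΩ : MeasurableSpace Ω} (Y : Ω → E) (κ : Kernel Ω E)
    (ν : Measure Ω) : Prop :=
  ∀ C, MeasurableSet[m] C → ∀ B, MeasurableSet B → ν (C ∩ Y ⁻¹' B) = ∫⁻ y in C, κ y B ∂ν

theorem HasCondLaw.mono (h : HasCondLaw m' Y κ ν) (hm : m ≤ m') : HasCondLaw m Y κ ν :=
  fun C hC => h C (hm C hC)

theorem HasCondLaw.congr (h : HasCondLaw m Y κ ν) (hm : m ≤ m') (hm' : m' ≤ mΩ)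
    (hY : Measurable[m'] Y) (hκ : Measurable[m] κ) (hμν : AgreeOn m' μ ν) :
    HasCondLaw m Y κ μ := fun C hC B hB => by
  rw [hμν _ ((hm C hC).inter (hY hB)), h C hC B hB]
  exact (hμν.setLIntegral_eq hm' ((Measure.measurable_coe hB).comp (hκ.mono hm le_rfl))
    (hm C hC)).symm

theorem HasCondLaw.measure_inter_eq (hμ : HasCondLaw m Y κ μ) (hν : HasCondLaw m Y κ ν)
    {m₀ : MeasurableSpace Ω} (hm₀ : m₀ ≤ m) (hm : m ≤ mΩ) (hκ : Measurable[m₀] κ)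
    (hμν : AgreeOn m₀ μ ν) {C : Set Ω} (hC : MeasurableSet[m₀] C) {B : Set E}
    (hB : MeasurableSet B) : μ (C ∩ Y ⁻¹' B) = ν (C ∩ Y ⁻¹' B) := by
  rw [hμ C (hm₀ C hC) B hB, hν C (hm₀ C hC) B hB]
  exact hμν.setLIntegral_eq (hm₀.trans hm) ((Measure.measurable_coe hB).comp hκ) hC

theorem HasCondLaw.agreeOn_restrict_withDensity (h : HasCondLaw m Y κ ν) (hm : m ≤ mΩ)
    {B : Set E} (hB : MeasurableSet B) :
    AgreeOn m (ν.restrict (Y ⁻¹' B)) (ν.withDensity fun y => κ y B) := fun C hC => by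
  rw [Measure.restrict_apply (hm C hC), withDensity_apply _ (hm C hC), h C hC B hB]

theorem HasCondLaw.withDensity (h : HasCondLaw m Y κ ν) (hm : m ≤ mΩ) (hY : Measurable Y)
    (hκ : Measurable[m] κ) {f : Ω → ℝ≥0∞} (hf : Measurable[m] f) :
    HasCondLaw m Y κ (ν.withDensity f) := fun C hC B hB => by
  have hCm := hm C hC
  have hκB : Measurable[m] fun y => κ y B := (Measure.measurable_coe hB).comp hκ
  have hfm : Measurable f := hf.mono hm le_rfl
  calc ν.withDensity f (C ∩ Y ⁻¹' B)
      = ∫⁻ y in C, f y ∂ν.restrict (Y ⁻¹' B) := by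
        rw [withDensity_apply _ (hCm.inter (hY hB)), Measure.restrict_restrict hCm]
    _ = ∫⁻ y in C, f y ∂ν.withDensity fun y => κ y B :=
        (h.agreeOn_restrict_withDensity hm hB).setLIntegral_eq hm hf hC
    _ = ∫⁻ y in C, κ y B * f y ∂ν :=
        setLIntegral_withDensity_eq_setLIntegral_mul _ (hκB.mono hm le_rfl) hfm hCm
    _ = ∫⁻ y in C, f y * κ y B ∂ν := by simp_rw [mul_comm]
    _ = ∫⁻ y in C, κ y B ∂ν.withDensity f :=
        (setLIntegral_withDensity_eq_setLIntegral_mul _ hfm (hκB.mono hm le_rfl) hCm).symm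

theorem HasCondLaw.bind {Ω' : Type*} [MeasurableSpace Ω'] {Q : Kernel Ω' Ω}
    (h : ∀ x, HasCondLaw m Y κ (Q x)) (hm : m ≤ mΩ) (hY : Measurable Y) (ρ : Measure Ω') :
    HasCondLaw m Y κ (ρ.bind Q) := fun C hC B hB => by
  have hCm := hm C hC
  rw [Measure.bind_apply (hCm.inter (hY hB)) Q.aemeasurable, ← lintegral_indicator hCm,
    Measure.lintegral_bind Q.aemeasurable
      ((Kernel.measurable_coe κ hB).indicator hCm).aemeasurable]
  simp_rw [lintegral_indicator hCm, fun x => h x C hC B hB]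

theorem hasCondLaw_iff_condExp [IsMarkovKernel κ] [IsFiniteMeasure ν] (hm : m ≤ mΩ)
    (hY : Measurable Y) (hκ : Measurable[m] κ) :
    HasCondLaw m Y κ ν ↔
      ∀ B, MeasurableSet B → (fun y => (κ y B).toReal) =ᵐ[ν] ν⟦Y ⁻¹' B | m⟧ := by
  have hκB : ∀ B, MeasurableSet B → Measurable[m] fun y => (κ y B).toReal := fun B hB =>
    ((Measure.measurable_coe hB).comp hκ).ennreal_toReal
  have hint : ∀ B, MeasurableSet B → Integrable (fun y => (κ y B).toReal) ν := fun B hB =>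
    .of_bound ((hκB B hB).mono hm le_rfl).aestronglyMeasurable 1 <| .of_forall fun y => by
      rw [Real.norm_of_nonneg ENNReal.toReal_nonneg]
      exact measureReal_le_one
  have hset : ∀ B, MeasurableSet B → ∀ C,
      (ν (C ∩ Y ⁻¹' B) = ∫⁻ y in C, κ y B ∂ν ↔
        ∫ y in C, (κ y B).toReal ∂ν = ∫ y in C, (Y ⁻¹' B).indicator (fun _ => (1 : ℝ)) y ∂ν) := by
    intro B hB C
    have hfin : ∫⁻ y in C, κ y B ∂ν ≠ ∞ :=
      ne_top_of_le_ne_top (measure_ne_top ν C) <| by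
        rw [← setLIntegral_one]
        exact lintegral_mono fun y => prob_le_one
    rw [integral_toReal (Kernel.measurable_coe κ hB).aemeasurable
        (.of_forall fun _ => measure_lt_top _ _), setIntegral_indicator (hY hB), setIntegral_const,
      smul_eq_mul, mul_one, measureReal_def, ENNReal.toReal_eq_toReal_iff' hfin
        (measure_ne_top _ _), eq_comm]
  have hindic : ∀ B, MeasurableSet B → Integrable ((Y ⁻¹' B).indicator fun _ => (1 : ℝ)) ν :=
    fun B hB => (integrable_const _).indicator (hY hB)
  refine ⟨fun h B hB => ?_, fun h C hC B hB => (hset B hB C).2 ?_⟩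
  · exact ae_eq_condExp_of_forall_setIntegral_eq hm (hindic B hB)
      (fun _ _ _ => (hint B hB).integrableOn) (fun C hC _ => (hset B hB C).1 (h C hC B hB))
      (hκB B hB).stronglyMeasurable.aestronglyMeasurable
  · rw [← setIntegral_condExp hm (hindic B hB) hC]
    exact integral_congr_ae (ae_restrict_of_ae (h B hB))

end HasCondLaw

section CondIndepGiven

variable {Ω : Type*} {m m₁ m₂ mΩ : MeasurableSpace Ω} {μ : Measure Ω} [IsFiniteMeasure μ]

theorem condExp_indicator_condExp_ae_eq_mul {A B : Set Ω} (hB : MeasurableSet B) :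
    μ[B.indicator (μ⟦A | m⟧) | m] =ᵐ[μ] μ⟦A | m⟧ * μ⟦B | m⟧ := by
  have hmul : B.indicator (μ⟦A | m⟧) = μ⟦A | m⟧ * B.indicator fun _ => (1 : ℝ) := by
    ext x
    by_cases hx : x ∈ B <;> simp [hx]
  rw [hmul]
  exact condExp_mul_of_stronglyMeasurable_left stronglyMeasurable_condExp
    (hmul ▸ integrable_condExp.indicator hB) ((integrable_const _).indicator hB)

theorem condIndepGiven_iff_condExp_ae_eq (hm : m ≤ m₂) (hm₁ : m₁ ≤ mΩ) (hm₂ : m₂ ≤ mΩ) :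
    CondIndepGiven m m₁ m₂ μ ↔ ∀ A, MeasurableSet[m₁] A → μ⟦A | m₂⟧ =ᵐ[μ] μ⟦A | m⟧ := by
  have hindic : ∀ A, MeasurableSet A → Integrable (A.indicator fun _ => (1 : ℝ)) μ :=
    fun A hA => (integrable_const _).indicator hA
  refine ⟨fun h A hA => ?_, fun h A B hA hB => ?_⟩
  · refine (ae_eq_condExp_of_forall_setIntegral_eq hm₂ (hindic A (hm₁ A hA))
      (fun _ _ _ => integrable_condExp.integrableOn) (fun B hB _ => ?_)
      (stronglyMeasurable_condExp.mono hm).aestronglyMeasurable).symm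
    have hBm := hm₂ B hB
    calc ∫ x in B, (μ⟦A | m⟧) x ∂μ
        = ∫ x, (μ[B.indicator (μ⟦A | m⟧) | m]) x ∂μ := by
          rw [integral_condExp (hm.trans hm₂), integral_indicator hBm]
      _ = ∫ x, (μ⟦A ∩ B | m⟧) x ∂μ :=
          integral_congr_ae ((condExp_indicator_condExp_ae_eq_mul hBm).trans (h A B hA hB).symm)
      _ = ∫ x in B, A.indicator (fun _ => (1 : ℝ)) x ∂μ := by
          rw [integral_condExp (hm.trans hm₂), Set.inter_comm, ← Set.indicator_indicator,
            integral_indicator hBm]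
  · calc μ⟦A ∩ B | m⟧
        =ᵐ[μ] μ[μ[B.indicator (A.indicator fun _ => (1 : ℝ)) | m₂] | m] := by
          rw [Set.indicator_indicator, Set.inter_comm B]
          exact (condExp_condExp_of_le hm hm₂).symm
      _ =ᵐ[μ] μ[B.indicator (μ⟦A | m₂⟧) | m] :=
          condExp_congr_ae (condExp_indicator (hindic A (hm₁ A hA)) hB)
      _ =ᵐ[μ] μ[B.indicator (μ⟦A | m⟧) | m] := by
          refine condExp_congr_ae ?_
          filter_upwards [h A hA] with x hx
          simp only [Set.indicator, hx]
      _ =ᵐ[μ] μ⟦A | m⟧ * μ⟦B | m⟧ := condExp_indicator_condExp_ae_eq_mul (hm₂ B hB)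

end CondIndepGiven

section Cylinders

variable {V : Type*} {X : V → Type*} [∀ v, MeasurableSpace (X v)] {S : Set V}

theorem cylinderEvents_eq_comap_restrict (S : Set V) :
    cylinderEvents (X := X) S = MeasurableSpace.comap (fun x (u : S) => x u.1) inferInstance := by
  rw [cylinderEvents, MeasurableSpace.pi, MeasurableSpace.comap_iSup, iSup_subtype']
  simp only [MeasurableSpace.comap_comp]
  rfl

theorem ae_mem_iff_mem_of_cylinderEvents {Ω : Type*} [MeasurableSpace Ω] {μ : Measure Ω}
    {f g : Ω → ∀ v, X v}
    (h : ∀ v ∈ S, ∀ B : Set (X v), MeasurableSet B → ∀ᵐ ω ∂μ, f ω v ∈ B ↔ g ω v ∈ B)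
    {C : Set (∀ v, X v)} (hC : MeasurableSet[cylinderEvents S] C) :
    ∀ᵐ ω ∂μ, f ω ∈ C ↔ g ω ∈ C := by
  let m : MeasurableSpace (∀ v, X v) :=
    { MeasurableSet' := fun C => ∀ᵐ ω ∂μ, f ω ∈ C ↔ g ω ∈ C
      measurableSet_empty := .of_forall fun _ => Iff.rfl
      measurableSet_compl := fun C hC => hC.mono fun ω => not_congr
      measurableSet_iUnion := fun C hC => by
        filter_upwards [ae_all_iff.2 hC] with ω hω
        simp only [Set.mem_iUnion, hω] }
  have hle : cylinderEvents S ≤ m := iSup₂_le fun v hv => by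
    rintro _ ⟨B, hB, rfl⟩
    exact h v hv B hB
  exact hle C hC

theorem agreeOn_cylinderEvents_of_forall_max [LinearOrder V] {μ ν : Measure (∀ v, X v)}
    [IsFiniteMeasure μ] (huniv : μ Set.univ = ν Set.univ)
    (hmax : ∀ s ∈ S, ∀ C, MeasurableSet[cylinderEvents (S ∩ Set.Iio s)] C →
      ∀ B : Set (X s), MeasurableSet B →
        μ (C ∩ (fun x => x s) ⁻¹' B) = ν (C ∩ (fun x => x s) ⁻¹' B)) :
    AgreeOn (cylinderEvents S) μ ν := fun C hC => by
  refine ext_on_measurableSpace_of_generate_finite _ _ ?_ cylinderEvents_le_pi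
    (generateFrom_piiUnionInter_measurableSet
      (fun v => (inferInstance : MeasurableSpace (X v)).comap fun x : ∀ v, X v => x v) S).symm
    (isPiSystem_piiUnionInter _ (fun v => @MeasurableSpace.isPiSystem_measurableSet _ (_)) _)
    huniv hC
  rintro _ ⟨t, htS, f, hf, rfl⟩
  obtain rfl | hne := t.eq_empty_or_nonempty
  · simpa using huniv
  have hst : t.max' hne ∈ t := t.max'_mem hne
  obtain ⟨B, hB, hBf⟩ := hf _ hst
  have hsplit : ⋂ v ∈ t, f v =
      (⋂ v ∈ t.erase (t.max' hne), f v) ∩ (fun x => x (t.max' hne)) ⁻¹' B := by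
    rw [hBf, Set.inter_comm, ← Finset.set_biInter_insert, Finset.insert_erase hst]
  rw [hsplit]
  refine hmax _ (htS hst) _ (Finset.measurableSet_biInter _ fun v hv => ?_) B hB
  obtain ⟨hvs, hvt⟩ := Finset.mem_erase.1 hv
  obtain ⟨B', hB', hBf'⟩ := hf v hvt
  have hv' : v ∈ S ∩ Set.Iio (t.max' hne) := ⟨htS hvt, (t.le_max' v hvt).lt_of_ne hvs⟩
  exact hBf' ▸ measurable_cylinderEvent_apply hv' hB'

theorem agreeOn_cylinderEvents [LinearOrder V] [WellFoundedLT V] {μ ν : Measure (∀ v, X v)}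
    [IsFiniteMeasure μ] (huniv : μ Set.univ = ν Set.univ)
    (hmax : ∀ s ∈ S, AgreeOn (cylinderEvents (S ∩ Set.Iio s)) μ ν →
      ∀ C, MeasurableSet[cylinderEvents (S ∩ Set.Iio s)] C → ∀ B : Set (X s), MeasurableSet B →
        μ (C ∩ (fun x => x s) ⁻¹' B) = ν (C ∩ (fun x => x s) ⁻¹' B)) :
    AgreeOn (cylinderEvents S) μ ν := by
  have hlt : ∀ s, AgreeOn (cylinderEvents (S ∩ Set.Iio s)) μ ν := fun s => by
    induction s using WellFoundedLT.induction with
    | _ s ih =>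
      refine agreeOn_cylinderEvents_of_forall_max huniv fun r hr => ?_
      rw [Set.inter_assoc, Set.Iio_inter_Iio, min_eq_right hr.2.le]
      exact hmax r hr.1 (ih r hr.2)
  exact agreeOn_cylinderEvents_of_forall_max huniv fun s hs => hmax s hs (hlt s)

end Cylinders

section MarkovChain

open Finset Preorder

theorem map_compProd {α β γ : Type*} [MeasurableSpace α] [MeasurableSpace β] [MeasurableSpace γ]
    (μ : Measure α) [SFinite μ] {f : α → β} (hf : Measurable f) (κ : Kernel β γ)
    [IsSFiniteKernel κ] : μ.map f ⊗ₘ κ = (μ ⊗ₘ κ.comap f hf).map (Prod.map f id) := by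
  have hf' : Measurable (Prod.map f (id : γ → γ)) := hf.prodMap measurable_id
  ext s hs
  rw [Measure.map_apply hf' hs, Measure.compProd_apply hs, Measure.compProd_apply (hf' hs),
    lintegral_map (Kernel.measurable_kernel_prodMk_left hs) hf]
  rfl

variable {E : Type*} [MeasurableSpace E] (Q : ℕ → Kernel E E) [∀ n, IsMarkovKernel (Q n)]

/-- The step `n` of a Markov chain with transition kernels `Q`, as a function of its whole past. -/
noncomputable def markovStep (n : ℕ) : Kernel (Π _ : Iic n, E) E :=
  (Q n).comap (fun z => z ⟨n, mem_Iic.2 le_rfl⟩) (measurable_pi_apply _)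

instance (n : ℕ) : IsMarkovKernel (markovStep Q n) := by
  unfold markovStep
  infer_instance

/-- The law of the inhomogeneous Markov chain with transition kernels `Q`, as a function of its
starting point. -/
noncomputable def markovChain : Kernel E (ℕ → E) :=
  (Kernel.traj (X := fun _ => E) (markovStep Q) 0).comap (fun x _ => x)
    (measurable_pi_lambda _ fun _ => measurable_id)

instance : IsMarkovKernel (markovChain Q) := by
  unfold markovChain
  infer_instance

theorem markovChain_map_zero (x : E) :
    (markovChain Q x).map (fun ω => ω 0) = Measure.dirac x := by
  have hev : Measurable fun z : Π _ : Iic 0, E => z ⟨0, mem_Iic.2 le_rfl⟩ := measurable_pi_apply _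
  calc (markovChain Q x).map (fun ω => ω 0)
      = (((markovChain Q x).map (frestrictLe (π := fun _ => E) 0)).map
          fun z => z ⟨0, mem_Iic.2 le_rfl⟩) := by
        rw [Measure.map_map hev (measurable_frestrictLe _)]
        rfl
    _ = (Measure.dirac fun _ : Iic 0 => x).map fun z => z ⟨0, mem_Iic.2 le_rfl⟩ := by
        rw [markovChain, Kernel.comap_apply, Kernel.traj_map_frestrictLe_apply,
          Kernel.partialTraj_self, Kernel.id_apply]
    _ = Measure.dirac x := Measure.map_dirac' hev _

theorem markovChain_map_pair (x : E) (n : ℕ) :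
    (markovChain Q x).map (fun ω => (ω n, ω (n + 1))) =
      ((markovChain Q x).map fun ω => ω n) ⊗ₘ Q n := by
  have hev : Measurable fun z : Π _ : Iic n, E => z ⟨n, mem_Iic.2 le_rfl⟩ := measurable_pi_apply _
  have hstep := Kernel.partialTraj_compProd_eq_map_traj (X := fun _ => E) (κ := markovStep Q)
    (Nat.zero_le n) (x₀ := fun _ => x)
  rw [← Kernel.traj_map_frestrictLe_apply] at hstep
  calc (markovChain Q x).map (fun ω => (ω n, ω (n + 1)))
      = ((markovChain Q x).map fun ω => (frestrictLe (π := fun _ => E) n ω, ω (n + 1))).map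
          (Prod.map (fun z => z ⟨n, mem_Iic.2 le_rfl⟩) id) := by
        rw [Measure.map_map (hev.prodMap measurable_id) (by fun_prop)]
        rfl
    _ = ((markovChain Q x).map (frestrictLe (π := fun _ => E) n) ⊗ₘ markovStep Q n).map
          (Prod.map (fun z => z ⟨n, mem_Iic.2 le_rfl⟩) id) := by
        rw [markovChain, Kernel.comap_apply, hstep]
    _ = (((markovChain Q x).map (frestrictLe (π := fun _ => E) n)).map
          fun z => z ⟨n, mem_Iic.2 le_rfl⟩) ⊗ₘ Q n := (map_compProd _ hev _).symm
    _ = ((markovChain Q x).map fun ω => ω n) ⊗ₘ Q n := by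
        rw [Measure.map_map hev (measurable_frestrictLe _)]
        rfl

theorem markovChain_map_succ (x : E) (n : ℕ) :
    (markovChain Q x).map (fun ω => ω (n + 1)) =
      ((markovChain Q x).map fun ω => ω n).bind (Q n) := by
  rw [← Measure.snd_compProd, ← markovChain_map_pair, Measure.snd_map_prodMk (by fun_prop)]

theorem ae_markovChain_pair (x : E) (n : ℕ) {p : E × E → Prop} (hp : MeasurableSet {z | p z})
    (h : ∀ y, ∀ᵐ z ∂Q n y, p (y, z)) : ∀ᵐ ω ∂markovChain Q x, p (ω n, ω (n + 1)) := by
  have hae := Measure.ae_compProd_of_ae_ae (μ := (markovChain Q x).map fun ω => ω n) hp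
    (.of_forall h)
  rw [← markovChain_map_pair] at hae
  exact ae_of_ae_map (by fun_prop) hae

end MarkovChain

section Resampling

variable {V : Type*} [LinearOrder V] {X : V → Type*} [∀ v, MeasurableSpace (X v)]

/-- `ν` is a law of the random point that arises from `x` when the coordinates in `I` are
resampled, in increasing order, according to the kernels `K`, and the others are kept. -/
structure IsResampling (K : ∀ v, Kernel (∀ v, X v) (X v)) (I : Set V) (x : ∀ v, X v)
    (ν : Measure (∀ v, X v)) : Prop where
  isProbabilityMeasure : IsProbabilityMeasure ν
  fixed : AgreeOn (cylinderEvents Iᶜ) ν (Measure.dirac x)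
  step : ∀ v ∈ I, HasCondLaw (cylinderEvents (Set.Iio v)) (fun y => y v) (K v) ν

/-- `P` resamples the coordinates in `I` of every point, in the sense of `IsResampling`. -/
def IsResamplingKernel (K : ∀ v, Kernel (∀ v, X v) (X v)) (I : Set V)
    (P : Kernel (∀ v, X v) (∀ v, X v)) : Prop :=
  ∀ x, IsResampling K I x (P x)

variable {K : ∀ v, Kernel (∀ v, X v) (X v)} {I J : Set V} {x : ∀ v, X v}
  {ν ν' : Measure (∀ v, X v)}

theorem IsResamplingKernel.isMarkovKernel {P : Kernel (∀ v, X v) (∀ v, X v)}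
    (h : IsResamplingKernel K I P) : IsMarkovKernel P :=
  ⟨fun x => (h x).isProbabilityMeasure⟩

theorem isResampling_empty_dirac (K : ∀ v, Kernel (∀ v, X v) (X v)) (x : ∀ v, X v) :
    IsResampling K ∅ x (Measure.dirac x) where
  isProbabilityMeasure := inferInstance
  fixed _ _ := rfl
  step _ hv := hv.elim

theorem IsResampling.agreeOn [WellFoundedLT V]
    (hK : ∀ v, Measurable[cylinderEvents (Set.Iio v)] (K v)) (hI : IsResampling K I x ν)
    (hJ : IsResampling K J x ν') (hJI : J ⊆ I) (hlow : ∀ v ∈ J, Set.Iio v ⊆ Iᶜ ∪ J) :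
    AgreeOn (cylinderEvents (Iᶜ ∪ J)) ν ν' := by
  have := hI.isProbabilityMeasure
  have := hJ.isProbabilityMeasure
  refine agreeOn_cylinderEvents (by simp only [measure_univ]) fun s hs hag C hC B hB => ?_
  rcases hs with hsI | hsJ
  · have hsJ : s ∈ Jᶜ := Set.compl_subset_compl.2 hJI hsI
    rw [hI.fixed.measure_inter_of_dirac cylinderEvents_le_pi C
        (measurable_cylinderEvent_apply hsI hB),
      hJ.fixed.measure_inter_of_dirac cylinderEvents_le_pi C
        (measurable_cylinderEvent_apply hsJ hB), hag C hC]
  · exact (hI.step s (hJI hsJ)).measure_inter_eq (hJ.step s hsJ)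
      (cylinderEvents_mono Set.inter_subset_right) cylinderEvents_le_pi
      ((hK s).mono (cylinderEvents_mono (Set.subset_inter (hlow s hsJ) subset_rfl)) le_rfl)
      hag hC hB

theorem IsResampling.iUnion {ι : Type*} [Nonempty ι] {J : ι → Set V}
    {ν' : ι → Measure (∀ v, X v)} (hK : ∀ v, Measurable[cylinderEvents (Set.Iio v)] (K v))
    (hlow : ∀ i, ∀ v ∈ J i, Set.Iio v ⊆ (⋃ i, J i)ᶜ ∪ J i)
    (h : ∀ i, IsResampling K (J i) x (ν' i))
    (hag : ∀ i, AgreeOn (cylinderEvents ((⋃ i, J i)ᶜ ∪ J i)) ν (ν' i)) :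
    IsResampling K (⋃ i, J i) x ν where
  isProbabilityMeasure := by
    inhabit ι
    have := (h default).isProbabilityMeasure
    exact ⟨(hag default Set.univ MeasurableSet.univ).trans measure_univ⟩
  fixed := by
    inhabit ι
    exact ((hag default).mono (cylinderEvents_mono Set.subset_union_left)).trans <|
      (h default).fixed.mono <|
        cylinderEvents_mono (Set.compl_subset_compl.2 (Set.subset_iUnion J default))
  step v hv := by
    obtain ⟨i, hi⟩ := Set.mem_iUnion.1 hv
    exact ((h i).step v hi).congr (cylinderEvents_mono (hlow i v hi)) cylinderEvents_le_pi
      (measurable_cylinderEvent_apply (Or.inr hi)) (hK v) (hag i)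

theorem IsResamplingKernel.agreeOn_bind {Q : Kernel (∀ v, X v) (∀ v, X v)}
    (hQ : IsResamplingKernel K J Q) (ν : Measure (∀ v, X v)) :
    AgreeOn (cylinderEvents Jᶜ) (ν.bind Q) ν := fun C hC => by
  have hCm := cylinderEvents_le_pi C hC
  have hQC : ∀ y, Q y C = C.indicator 1 y := fun y => by
    rw [(hQ y).fixed C hC, Measure.dirac_apply' y hCm]
  simp_rw [Measure.bind_apply hCm Q.aemeasurable, hQC, lintegral_indicator_one hCm]

theorem IsResampling.bind (hK : ∀ v, Measurable[cylinderEvents (Set.Iio v)] (K v))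
    (h : IsResampling K I x ν) {Q : Kernel (∀ v, X v) (∀ v, X v)}
    (hQ : IsResamplingKernel K J Q) (hIJ : ∀ i ∈ I, ∀ j ∈ J, i < j) :
    IsResampling K (I ∪ J) x (ν.bind Q) where
  isProbabilityMeasure := by
    have := h.isProbabilityMeasure
    have := hQ.isMarkovKernel
    infer_instance
  fixed := by
    rw [Set.compl_union]
    exact ((hQ.agreeOn_bind ν).mono (cylinderEvents_mono Set.inter_subset_right)).trans
      (h.fixed.mono (cylinderEvents_mono Set.inter_subset_left))
  step v hv := by
    by_cases hvJ : v ∈ J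
    · exact .bind (fun y => (hQ y).step v hvJ) cylinderEvents_le_pi (measurable_pi_apply v) ν
    · have hvI : v ∈ I := hv.resolve_right hvJ
      have hlt : Set.Iio v ⊆ Jᶜ := fun u hu huJ => lt_asymm (hIJ v hvI u huJ) hu
      exact (h.step v hvI).congr (cylinderEvents_mono hlt) cylinderEvents_le_pi
        (measurable_cylinderEvent_apply hvJ) (hK v) (hQ.agreeOn_bind ν)

/-- The kernel that redraws the single coordinate `w` according to `κ`. -/
noncomputable def resampleAt (w : V) (κ : Kernel (∀ v, X v) (X w)) :
    Kernel (∀ v, X v) (∀ v, X v) :=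
  (Kernel.id ×ₖ κ).map fun p => Function.update p.1 w p.2

theorem resampleAt_apply (w : V) (κ : Kernel (∀ v, X v) (X w)) [IsSFiniteKernel κ]
    (x : ∀ v, X v) : resampleAt w κ x = (κ x).map (Function.update x w) := by
  have hupd : Measurable fun p : (∀ v, X v) × X w => Function.update p.1 w p.2 := measurable_update'
  rw [resampleAt, Kernel.map_apply _ hupd, Kernel.prod_apply, Kernel.id_apply, Measure.dirac_prod,
    Measure.map_map hupd measurable_prodMk_left]
  rfl

theorem isResamplingKernel_resampleAt {w : V} [IsMarkovKernel (K w)]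
    (hK : Measurable[cylinderEvents (Set.Iio w)] (K w)) :
    IsResamplingKernel K {w} (resampleAt w (K w)) := fun x => by
  have hupd : Measurable (Function.update x w) := measurable_update x
  have hprob : IsProbabilityMeasure (resampleAt w (K w) x) := by
    rw [resampleAt_apply]
    exact Measure.isProbabilityMeasure_map hupd.aemeasurable
  have hfixed : AgreeOn (cylinderEvents {w}ᶜ) (resampleAt w (K w) x) (Measure.dirac x) := by
    refine (agreeOn_dirac_iff cylinderEvents_le_pi).2 fun C hC => ?_
    refine ae_mem_iff_mem_of_cylinderEvents (g := fun _ => x) (fun v hv B hB => ?_) hC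
    rw [resampleAt_apply, ae_map_iff hupd.aemeasurable
      ((measurable_pi_apply v hB).iff (MeasurableSet.const _))]
    exact .of_forall fun b => by simp only [Function.update_of_ne hv]
  refine ⟨hprob, hfixed, ?_⟩
  rintro v rfl C hC B hB
  have hlt : cylinderEvents (X := X) (Set.Iio v) ≤ cylinderEvents {v}ᶜ :=
    cylinderEvents_mono fun u hu => ne_of_lt hu
  have hcoord : resampleAt v (K v) x ((fun y => y v) ⁻¹' B) = K v x B := by
    rw [resampleAt_apply, Measure.map_apply hupd (measurable_pi_apply v hB)]
    simp only [← Set.preimage_comp, Function.comp_def, Function.update_self, Set.preimage_id']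
  have hKB : Measurable[cylinderEvents {v}ᶜ] fun y => K v y B :=
    (Measure.measurable_coe hB).comp (hK.mono hlt le_rfl)
  rw [Set.inter_comm, hfixed.measure_inter_of_dirac cylinderEvents_le_pi _ (hlt C hC), hcoord,
    hfixed.setLIntegral_eq cylinderEvents_le_pi hKB (hlt C hC),
    ← lintegral_indicator (cylinderEvents_le_pi C hC),
    lintegral_dirac' x ((hKB.mono cylinderEvents_le_pi le_rfl).indicator
      (cylinderEvents_le_pi C hC))]
  rfl

end Resampling

section MonotoneUnion

variable {V : Type*} [LinearOrder V] {X : V → Type*} [∀ v, MeasurableSpace (X v)]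
  {K : ∀ v, Kernel (∀ v, X v) (X v)} {J : ℕ → Set V} {Q : ℕ → Kernel (∀ v, X v) (∀ v, X v)}
  [∀ n, IsMarkovKernel (Q n)]

theorem isResampling_map_markovChain
    (hK : ∀ v, Measurable[cylinderEvents (Set.Iio v)] (K v)) (hJ0 : J 0 = ∅) (hmono : Monotone J)
    (hlow : ∀ n, ∀ v ∈ J n, Set.Iio v ⊆ (⋃ n, J n)ᶜ ∪ J n)
    (hQ : ∀ n, IsResamplingKernel K (J (n + 1) \ J n) (Q n)) (x : ∀ v, X v) (n : ℕ) :
    IsResampling K (J n) x ((markovChain Q x).map fun ω => ω n) := by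
  induction n with
  | zero =>
    rw [markovChain_map_zero, hJ0]
    exact isResampling_empty_dirac K x
  | succ n ih =>
    rw [markovChain_map_succ, ← Set.union_sdiff_cancel (hmono n.le_succ)]
    refine ih.bind hK (hQ n) fun i hi j hj => lt_of_not_ge fun hji => hj.2 ?_
    obtain rfl | hlt := hji.eq_or_lt
    · exact hi
    · exact (hlow n i hi hlt).resolve_left (not_not_intro (Set.mem_iUnion_of_mem _ hj.1))

theorem ae_markovChain_mem_iff_mem (hmono : Monotone J)
    (hQ : ∀ n, IsResamplingKernel K (J (n + 1) \ J n) (Q n)) (x : ∀ v, X v) {m n : ℕ}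
    (hmn : m ≤ n) {C : Set (∀ v, X v)}
    (hC : MeasurableSet[cylinderEvents ((⋃ n, J n)ᶜ ∪ J m)] C) :
    ∀ᵐ ω ∂markovChain Q x, ω m ∈ C ↔ ω n ∈ C := by
  induction n, hmn using Nat.le_induction with
  | base => exact .of_forall fun _ => Iff.rfl
  | succ n hmn ih =>
    have hsub : (⋃ n, J n)ᶜ ∪ J m ⊆ (J (n + 1) \ J n)ᶜ := by
      rintro v (hv | hv) hvJ
      · exact hv (Set.mem_iUnion_of_mem _ hvJ.1)
      · exact hvJ.2 (hmono hmn hv)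
    have hCm := cylinderEvents_le_pi C hC
    have hstep : ∀ᵐ ω ∂markovChain Q x, ω n ∈ C ↔ ω (n + 1) ∈ C :=
      ae_markovChain_pair Q x n (p := fun z => z.1 ∈ C ↔ z.2 ∈ C)
        ((measurable_fst hCm).iff (measurable_snd hCm)) fun y => by
          have := (hQ n y).isProbabilityMeasure
          filter_upwards [(agreeOn_dirac_iff cylinderEvents_le_pi).1 (hQ n y).fixed C
            (cylinderEvents_mono hsub C hC)] with z hz using hz.symm
    filter_upwards [ih, hstep] with ω using Iff.trans

theorem exists_isResamplingKernel_iUnion_nat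
    (hK : ∀ v, Measurable[cylinderEvents (Set.Iio v)] (K v)) (hJ0 : J 0 = ∅) (hmono : Monotone J)
    (hlow : ∀ n, ∀ v ∈ J n, Set.Iio v ⊆ (⋃ n, J n)ᶜ ∪ J n)
    (hQ : ∀ n, IsResamplingKernel K (J (n + 1) \ J n) (Q n)) :
    ∃ P, IsResamplingKernel K (⋃ n, J n) P := by
  have hsettled : ∀ v, ∃ n, v ∈ (⋃ n, J n)ᶜ ∪ J n := fun v => by
    by_cases hv : v ∈ ⋃ n, J n
    · exact (Set.mem_iUnion.1 hv).imp fun _ => Or.inr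
    · exact ⟨0, Or.inl hv⟩
  choose N hN using hsettled
  let L : (ℕ → ∀ v, X v) → ∀ v, X v := fun ω v => ω (N v) v
  have hL : Measurable L :=
    measurable_pi_lambda _ fun v => (measurable_pi_apply v).comp (measurable_pi_apply (N v))
  have hLmem : ∀ x n C, MeasurableSet[cylinderEvents ((⋃ n, J n)ᶜ ∪ J n)] C →
      ∀ᵐ ω ∂markovChain Q x, L ω ∈ C ↔ ω n ∈ C := fun x n C hC => by
    refine ae_mem_iff_mem_of_cylinderEvents (fun v hv B hB => ?_) hC
    obtain hle | hle := le_total (N v) n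
    · exact ae_markovChain_mem_iff_mem hmono hQ x hle (measurable_cylinderEvent_apply (hN v) hB)
    · filter_upwards [ae_markovChain_mem_iff_mem hmono hQ x hle
        (measurable_cylinderEvent_apply hv hB)] with ω hω using hω.symm
  refine ⟨(markovChain Q).map L, fun x => ?_⟩
  rw [Kernel.map_apply _ hL]
  refine .iUnion hK hlow (isResampling_map_markovChain hK hJ0 hmono hlow hQ x) fun n C hC => ?_
  have hCm := cylinderEvents_le_pi C hC
  rw [Measure.map_apply hL hCm, Measure.map_apply (measurable_pi_apply n) hCm]
  exact measure_congr (Filter.eventuallyEq_set.2 (hLmem x n C hC))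

theorem exists_isResamplingKernel_of_cofinal_seq
    (hK : ∀ v, Measurable[cylinderEvents (Set.Iio v)] (K v))
    {I : Set V} (hI : ∀ u ∈ I, ∀ J ⊆ I ∩ Set.Iic u, ∃ P, IsResamplingKernel K J P)
    {s : ℕ → V} (hsI : ∀ n, s n ∈ I) (hs : ∀ u ∈ I, ∃ n, u ≤ s n) :
    ∃ P, IsResamplingKernel K I P := by
  let J : ℕ → Set V := fun n => {u | u ∈ I ∧ ∃ k < n, u ≤ s k}
  have hJI : ⋃ n, J n = I := by
    refine subset_antisymm (Set.iUnion_subset fun n u hu => hu.1) fun u hu => ?_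
    obtain ⟨k, hk⟩ := hs u hu
    exact Set.mem_iUnion.2 ⟨k + 1, hu, k, k.lt_succ_self, hk⟩
  have hJ0 : J 0 = ∅ := Set.eq_empty_of_forall_notMem fun u ⟨_, k, hk, _⟩ => k.not_lt_zero hk
  have hmono : Monotone J := fun m n hmn u ⟨hu, k, hk, huk⟩ => ⟨hu, k, hk.trans_le hmn, huk⟩
  have hlow : ∀ n, ∀ v ∈ J n, Set.Iio v ⊆ (⋃ n, J n)ᶜ ∪ J n := by
    rintro n v ⟨-, k, hk, hvk⟩ u hu
    by_cases huI : u ∈ I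
    · exact Or.inr ⟨huI, k, hk, hu.le.trans hvk⟩
    · exact Or.inl fun h => huI (hJI.subset h)
  have hblock : ∀ n, ∃ P, IsResamplingKernel K (J (n + 1) \ J n) P := fun n => by
    obtain ⟨k, -, hk⟩ :=
      Finset.exists_max_image (Finset.range (n + 1)) s Finset.nonempty_range_add_one
    refine hI (s k) (hsI k) _ ?_
    rintro u ⟨⟨hu, l, hl, hul⟩, -⟩
    exact ⟨hu, hul.trans (hk l (Finset.mem_range.2 hl))⟩
  choose Q hQ using hblock
  have := fun n => (hQ n).isMarkovKernel
  exact hJI ▸ exists_isResamplingKernel_iUnion_nat hK hJ0 hmono hlow hQ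

end MonotoneUnion

section Gluing

variable {ι Ω : Type*} [Preorder ι] [Nonempty ι] {m : ι → MeasurableSpace Ω}

theorem exists_measurableSet_of_iSup (hm : Monotone m)
    (hbdd : ∀ s : ℕ → ι, BddAbove (Set.range s)) {A : Set Ω} (hA : MeasurableSet[⨆ i, m i] A) :
    ∃ i, MeasurableSet[m i] A := by
  let m' : MeasurableSpace Ω :=
    { MeasurableSet' := fun A => ∃ i, MeasurableSet[m i] A
      measurableSet_empty := ⟨Classical.arbitrary ι, @MeasurableSet.empty _ (_)⟩
      measurableSet_compl := fun A ⟨i, hi⟩ => ⟨i, hi.compl⟩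
      measurableSet_iUnion := fun f hf => by
        choose s hs using hf
        obtain ⟨i, hi⟩ := hbdd s
        exact ⟨i, .iUnion fun n => hm (hi ⟨n, rfl⟩) _ (hs n)⟩ }
  have hle : ⨆ i, m i ≤ m' := iSup_le fun i A hA => ⟨i, hA⟩
  exact hle A hA

theorem exists_kernel_agreeOn {α : Type*} [MeasurableSpace α] {mΩ : MeasurableSpace Ω}
    (hm : Monotone m) (hbdd : ∀ s : ℕ → ι, BddAbove (Set.range s)) (hsup : ⨆ i, m i = mΩ)
    {P : ι → Kernel α Ω} (hP : ∀ i j, i ≤ j → ∀ a, AgreeOn (m i) (P i a) (P j a)) :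
    ∃ κ : Kernel α Ω, ∀ i a, AgreeOn (m i) (κ a) (P i a) := by
  have hPij : ∀ i j a A, MeasurableSet[m i] A → MeasurableSet[m j] A → P i a A = P j a A := by
    intro i j a A hi hj
    obtain ⟨k, hk⟩ := hbdd fun n => if n = 0 then i else j
    exact (hP i k (hk ⟨0, rfl⟩) a A hi).trans (hP j k (hk ⟨1, rfl⟩) a A hj).symm
  have hstage : ∀ A, MeasurableSet A → ∃ i, MeasurableSet[m i] A := fun A hA =>
    exists_measurableSet_of_iSup hm hbdd (hsup ▸ hA)
  choose i hi using hstage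
  let μ : α → Measure Ω := fun a =>
    Measure.ofMeasurable (fun A hA => P (i A hA) a A) measure_empty fun f hf hdisj => by
      obtain ⟨k, hk⟩ := hbdd fun n => i (f n) (hf n)
      have hfk : ∀ n, MeasurableSet[m k] (f n) := fun n => hm (hk ⟨n, rfl⟩) _ (hi (f n) (hf n))
      rw [hPij _ k a _ (hi _ _) (MeasurableSet.iUnion hfk), measure_iUnion hdisj hf]
      exact tsum_congr fun n => hPij k _ a _ (hfk n) (hi _ _)
  have hμ : ∀ a A (hA : MeasurableSet A), μ a A = P (i A hA) a A := fun a A hA =>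
    Measure.ofMeasurable_apply A hA
  refine ⟨⟨μ, Measure.measurable_of_measurable_coe _ fun A hA => ?_⟩, fun j a A hA => ?_⟩
  · simp_rw [hμ _ A hA]
    exact Kernel.measurable_coe _ hA
  · have hAm : MeasurableSet A := hsup ▸ le_iSup m j A hA
    exact (hμ a A hAm).trans (hPij _ j a A (hi A hAm) hA)

end Gluing

section Existence

variable {V : Type*} [LinearOrder V] [WellFoundedLT V] {X : V → Type*}
  [∀ v, MeasurableSpace (X v)] {K : ∀ v, Kernel (∀ v, X v) (X v)} {I : Set V}

theorem exists_isResamplingKernel_iUnion_of_bddAbove {ι : Type*} [Preorder ι] [Nonempty ι]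
    {J : ι → Set V} (hK : ∀ v, Measurable[cylinderEvents (Set.Iio v)] (K v)) (hmono : Monotone J)
    (hbdd : ∀ s : ℕ → ι, BddAbove (Set.range s))
    (hlow : ∀ i, ∀ v ∈ J i, Set.Iio v ⊆ (⋃ i, J i)ᶜ ∪ J i)
    (hJ : ∀ i, ∃ P, IsResamplingKernel K (J i) P) : ∃ P, IsResamplingKernel K (⋃ i, J i) P := by
  choose P hP using hJ
  have hm : Monotone fun i => cylinderEvents (X := X) ((⋃ i, J i)ᶜ ∪ J i) := fun i j hij =>
    cylinderEvents_mono (Set.union_subset_union_right _ (hmono hij))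
  have hsup : ⨆ i, cylinderEvents (X := X) ((⋃ i, J i)ᶜ ∪ J i) = MeasurableSpace.pi := by
    refine le_antisymm (iSup_le fun i => cylinderEvents_le_pi) (iSup_le fun v => ?_)
    obtain ⟨i, hi⟩ : ∃ i, v ∈ (⋃ i, J i)ᶜ ∪ J i := by
      by_cases hv : v ∈ ⋃ i, J i
      · exact (Set.mem_iUnion.1 hv).imp fun _ => Or.inr
      · exact ⟨Classical.arbitrary ι, Or.inl hv⟩
    exact (measurable_cylinderEvent_apply hi).comap_le.trans
      (le_iSup (fun i => cylinderEvents (X := X) ((⋃ i, J i)ᶜ ∪ J i)) i)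
  have hcons : ∀ i j, i ≤ j → ∀ x,
      AgreeOn (cylinderEvents ((⋃ i, J i)ᶜ ∪ J i)) (P i x) (P j x) := fun i j hij x => by
    have hcompl : (⋃ i, J i)ᶜ ∪ J i ⊆ (J j)ᶜ ∪ J i :=
      Set.union_subset_union_left _ (Set.compl_subset_compl.2 (Set.subset_iUnion J j))
    exact ((hP j x).agreeOn hK (hP i x) (hmono hij)
      fun v hv => (hlow i v hv).trans hcompl).symm.mono (cylinderEvents_mono hcompl)
  obtain ⟨κ, hκ⟩ := exists_kernel_agreeOn hm hbdd hsup hcons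
  exact ⟨κ, fun x => .iUnion hK hlow (fun i => hP i x) fun i => hκ i x⟩

theorem exists_isResamplingKernel_of_initial
    (hK : ∀ v, Measurable[cylinderEvents (Set.Iio v)] (K v))
    (hI : ∀ u ∈ I, ∀ J ⊆ I ∩ Set.Iic u, ∃ P, IsResamplingKernel K J P) :
    ∃ P, IsResamplingKernel K I P := by
  obtain rfl | hne := I.eq_empty_or_nonempty
  · exact ⟨Kernel.id, fun x => by
      rw [Kernel.id_apply]
      exact isResampling_empty_dirac K x⟩
  by_cases hbdd : ∀ s : ℕ → I, BddAbove (Set.range s)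
  · have := hne.to_subtype
    let J : I → Set V := fun u => I ∩ Set.Iic u.1
    have hJI : ⋃ u, J u = I :=
      subset_antisymm (Set.iUnion_subset fun u => Set.inter_subset_left) fun u hu =>
        Set.mem_iUnion.2 ⟨⟨u, hu⟩, hu, le_rfl⟩
    have hmono : Monotone J := fun u w huw =>
      Set.inter_subset_inter_right _ (Set.Iic_subset_Iic.2 huw)
    have hlow : ∀ u, ∀ v ∈ J u, Set.Iio v ⊆ (⋃ u, J u)ᶜ ∪ J u := fun u v hv r hr => by
      by_cases hrI : r ∈ I
      · exact Or.inr ⟨hrI, hr.le.trans hv.2⟩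
      · exact Or.inl fun h => hrI (hJI.subset h)
    exact hJI ▸ exists_isResamplingKernel_iUnion_of_bddAbove hK hmono hbdd hlow fun u =>
      hI u u.2 _ subset_rfl
  · push Not at hbdd
    obtain ⟨s, hs⟩ := hbdd
    refine exists_isResamplingKernel_of_cofinal_seq hK hI (fun n => (s n).2) fun u hu => ?_
    obtain ⟨_, ⟨n, rfl⟩, hn⟩ := not_bddAbove_iff.1 hs ⟨u, hu⟩
    exact ⟨n, le_of_lt hn⟩

-- A transfinite version of the Ionescu-Tulcea theorem.
theorem exists_isResamplingKernel [∀ v, IsMarkovKernel (K v)]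
    (hK : ∀ v, Measurable[cylinderEvents (Set.Iio v)] (K v)) (I : Set V) :
    ∃ P, IsResamplingKernel K I P := by
  have main : ∀ w, ∀ J ⊆ Set.Iic w, ∃ P, IsResamplingKernel K J P := by
    intro w
    induction w using WellFoundedLT.induction with
    | _ w ih =>
      have hlt : ∀ J ⊆ Set.Iio w, ∃ P, IsResamplingKernel K J P := fun J hJ =>
        exists_isResamplingKernel_of_initial hK fun u hu J' hJ' =>
          ih u (hJ hu) J' (hJ'.trans Set.inter_subset_right)
      intro J hJ
      have hJw : J \ {w} ⊆ Set.Iio w := fun u hu => (hJ hu.1).lt_of_ne hu.2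
      by_cases hw : w ∈ J
      · obtain ⟨P, hP⟩ := hlt _ hJw
        refine ⟨resampleAt w (K w) ∘ₖ P, fun x => ?_⟩
        rw [Kernel.comp_apply, ← Set.sdiff_union_of_subset (Set.singleton_subset_iff.2 hw)]
        exact (hP x).bind hK (isResamplingKernel_resampleAt (hK w)) fun i hi j hj => hj ▸ hJw hi
      · exact hlt J fun u hu => (hJ hu).lt_of_ne fun h => hw (h ▸ hu)
  exact exists_isResamplingKernel_of_initial hK fun u _ J hJ =>
    main u J (hJ.trans Set.inter_subset_right)

end Existence

section LocalMarkov

variable {V : Type*} [LinearOrder V] [WellFoundedLT V] {X : V → Type*}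
  [∀ v, MeasurableSpace (X v)] {K : ∀ v, Kernel (∀ v, X v) (X v)}

theorem existsUnique_isResampling [∀ v, IsMarkovKernel (K v)]
    (hK : ∀ v, Measurable[cylinderEvents (Set.Iio v)] (K v)) (I : Set V) (x : ∀ v, X v) :
    ∃! μ, IsResampling K I x μ := by
  obtain ⟨P, hP⟩ := exists_isResamplingKernel hK I
  refine ⟨P x, hP x, fun μ hμ => Measure.ext fun A hA => ?_⟩
  have huniv : Iᶜ ∪ I = Set.univ := Set.compl_union_self I
  refine hμ.agreeOn hK (hP x) subset_rfl (fun v _ => huniv ▸ Set.subset_univ _) A ?_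
  rwa [huniv, cylinderEvents_univ]

theorem agreeOn_cylinderEvents_of_hasCondLaw {μ ν : Measure (∀ v, X v)} [IsFiniteMeasure μ]
    {pa : V → Set V} (hpa : ∀ v, pa v ⊆ Set.Iio v)
    (hK : ∀ v, Measurable[cylinderEvents (pa v)] (K v)) {S N : Set V} (hS : IsLowerSet S)
    (hμν : AgreeOn (cylinderEvents S) μ ν) (hN : ∀ s ∈ N, pa s ⊆ N)
    (hμ : ∀ s ∈ N \ S, HasCondLaw (cylinderEvents (Set.Iio s)) (fun y => y s) (K s) μ)
    (hν : ∀ s ∈ N \ S, HasCondLaw (cylinderEvents (Set.Iio s)) (fun y => y s) (K s) ν) :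
    AgreeOn (cylinderEvents N) μ ν := by
  refine agreeOn_cylinderEvents (hμν _ MeasurableSet.univ) fun s hs hag C hC B hB => ?_
  by_cases hsS : s ∈ S
  · have hlt : N ∩ Set.Iio s ⊆ S := fun u hu => hS (le_of_lt hu.2) hsS
    have hCS : MeasurableSet[cylinderEvents S] C := cylinderEvents_mono hlt C hC
    have hBS : MeasurableSet[cylinderEvents S] ((fun y : ∀ v, X v => y s) ⁻¹' B) :=
      measurable_cylinderEvent_apply hsS hB
    exact hμν _ (hCS.inter hBS)
  · have hpas : pa s ⊆ N ∩ Set.Iio s := Set.subset_inter (hN s hs) (hpa s)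
    exact (hμ s ⟨hs, hsS⟩).measure_inter_eq (hν s ⟨hs, hsS⟩)
      (cylinderEvents_mono Set.inter_subset_right) cylinderEvents_le_pi
      ((hK s).mono (cylinderEvents_mono hpas) le_rfl) hag hC hB

-- Restricting `μ` to `{y | y v ∈ B}` and weighting it by `K v · B` agree on the past of `v`. Both
-- multiply `μ` by a density in the past of each later `s`, which preserves the law of `y s` given
-- that past, so the agreement spreads to all of `N`.
theorem IsResampling.hasCondLaw_of_notMem {pa : V → Set V} (hpa : ∀ v, pa v ⊆ Set.Iio v)
    (hK : ∀ v, Measurable[cylinderEvents (pa v)] (K v)) {x : ∀ v, X v} {μ : Measure (∀ v, X v)}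
    (h : IsResampling K Set.univ x μ) {N : Set V} (hN : ∀ s ∈ N, pa s ⊆ N) {v : V} (hv : v ∉ N) :
    HasCondLaw (cylinderEvents N) (fun y => y v) (K v) μ := fun C hC B hB => by
  have := h.isProbabilityMeasure
  let A : Set (∀ v, X v) := (fun y => y v) ⁻¹' B
  have hrestrict : μ.withDensity (A.indicator 1) = μ.restrict A :=
    withDensity_indicator_one (measurable_pi_apply v hB)
  have hbase : AgreeOn (cylinderEvents (Set.Iio v)) (μ.restrict A)
      (μ.withDensity fun y => K v y B) :=
    (h.step v trivial).agreeOn_restrict_withDensity cylinderEvents_le_pi hB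
  have hlaw : ∀ s f, Measurable[cylinderEvents (Set.Iio s)] f →
      HasCondLaw (cylinderEvents (Set.Iio s)) (fun y => y s) (K s) (μ.withDensity f) :=
    fun s f hf => (h.step s trivial).withDensity cylinderEvents_le_pi (measurable_pi_apply s)
      ((hK s).mono (cylinderEvents_mono (hpa s)) le_rfl) hf
  have hlater : ∀ s ∈ N \ Set.Iio v, v ∈ Set.Iio s := fun s hs =>
    (not_lt.1 hs.2).lt_of_ne fun hvs => hv (hvs ▸ hs.1)
  have hag : AgreeOn (cylinderEvents N) (μ.restrict A) (μ.withDensity fun y => K v y B) := by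
    refine agreeOn_cylinderEvents_of_hasCondLaw hpa hK (isLowerSet_Iio v) hbase hN
      (fun s hs => hrestrict ▸ hlaw s _ ?_) fun s hs => hlaw s _ ?_
    · exact measurable_const.indicator (measurable_cylinderEvent_apply (hlater s hs) hB)
    · exact (Measure.measurable_coe hB).comp ((hK v).mono (cylinderEvents_mono
        ((hpa v).trans (Set.Iio_subset_Iio (le_of_lt (hlater s hs))))) le_rfl)
  have hCm := cylinderEvents_le_pi C hC
  rw [← Measure.restrict_apply hCm, ← withDensity_apply _ hCm, hag C hC]

end LocalMarkov

theorem WellFoundedDigraph.wellFounded {V : Type*} {E : V → V → Prop}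
    (h : WellFoundedDigraph E) : WellFounded E :=
  wellFounded_iff_isEmpty_descending_chain.2 ⟨fun a => h ⟨a.1, a.2⟩⟩

theorem WellFoundedDigraph.exists_wellFoundedLT {V : Type*} {E : V → V → Prop}
    (h : WellFoundedDigraph E) :
    ∃ _ : LinearOrder V, WellFoundedLT V ∧ ∀ u v, E u v → u < v := by
  have : IsWellFounded V E := ⟨h.wellFounded⟩
  exact ⟨IsWellFounded.wellOrderExtension E, IsWellFounded.wellOrderExtension.isWellFounded_lt E,
    fun u v huv => Prod.Lex.left _ _ (IsWellFounded.rank_lt_of_rel huv)⟩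

namespace MTBN

variable {V : Type*} (M : MTBN V)

theorem sigma_eq_cylinderEvents (U : Set V) : M.sigma U = cylinderEvents U :=
  (cylinderEvents_eq_comap_restrict U).symm

/-- The kernel of a vertex as a function of all coordinates, of which it reads the parents. -/
noncomputable def liftKernel (v : V) : Kernel (∀ v, M.X v) (M.X v) :=
  (M.K v).comap (fun x u => x u.1) (measurable_pi_lambda _ fun u => measurable_pi_apply u.1)

instance (v : V) : IsMarkovKernel (M.liftKernel v) := by
  have := M.markov v
  unfold liftKernel
  infer_instance

theorem measurable_liftKernel (v : V) :
    Measurable[cylinderEvents (M.pa v)] (M.liftKernel v) := by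
  rw [← sigma_eq_cylinderEvents]
  exact (M.K v).measurable.comp (comap_measurable _)

theorem pa_subset_nd (v : V) : M.pa v ⊆ M.nd v := fun _ hu hr =>
  M.wellFounded.wellFounded.transGen.irrefl.irrefl _ (Relation.TransGen.tail' hr hu)

theorem pa_subset_nd_of_mem {v s : V} (hs : s ∈ M.nd v) : M.pa s ⊆ M.nd v :=
  fun _ hu hr => hs (hr.tail hu)

theorem notMem_nd (v : V) : v ∉ M.nd v := fun h => h .refl

theorem represents_iff_hasCondLaw {μ : Measure (∀ v, M.X v)} [IsFiniteMeasure μ] :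
    M.Represents μ ↔
      ∀ v, HasCondLaw (cylinderEvents (M.nd v)) (fun x => x v) (M.liftKernel v) μ := by
  refine forall_congr' fun v => ?_
  have hpa : cylinderEvents (X := M.X) (M.pa v) ≤ cylinderEvents (M.nd v) :=
    cylinderEvents_mono (M.pa_subset_nd v)
  have hK := M.measurable_liftKernel v
  have hlaw_pa := hasCondLaw_iff_condExp (ν := μ) cylinderEvents_le_pi (measurable_pi_apply v) hK
  have hlaw_nd := hasCondLaw_iff_condExp (ν := μ) cylinderEvents_le_pi (measurable_pi_apply v)
    (hK.mono hpa le_rfl)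
  rw [sigma_eq_cylinderEvents, sigma_eq_cylinderEvents, sigma_eq_cylinderEvents,
    condIndepGiven_iff_condExp_ae_eq hpa cylinderEvents_le_pi cylinderEvents_le_pi]
  refine ⟨fun ⟨hind, hker⟩ => hlaw_nd.2 fun B hB => ?_, fun h => ⟨fun A hA => ?_, ?_⟩⟩
  · have hBv : MeasurableSet[cylinderEvents {v}] ((fun x : ∀ v, M.X v => x v) ⁻¹' B) :=
      measurable_cylinderEvent_apply (Set.mem_singleton v) hB
    exact (hker B hB).trans (hind _ hBv).symm
  · rw [cylinderEvents, iSup_singleton] at hA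
    obtain ⟨B, hB, rfl⟩ := hA
    exact (hlaw_nd.1 h B hB).symm.trans (hlaw_pa.1 (h.mono hpa) B hB)
  · exact hlaw_pa.1 (h.mono hpa)

theorem isResampling_univ_iff_represents [LinearOrder V] [WellFoundedLT V]
    (hlt : ∀ u v, M.Edge u v → u < v) {x : ∀ v, M.X v} {μ : Measure (∀ v, M.X v)} :
    IsResampling M.liftKernel Set.univ x μ ↔ IsProbabilityMeasure μ ∧ M.Represents μ := by
  have hreach : Relation.ReflTransGen M.Edge ≤ (· ≤ ·) :=
    Relation.reflTransGen_le_of_le fun u v huv => (hlt u v huv).le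
  have hnd : ∀ v, Set.Iio v ⊆ M.nd v := fun v u hu hr => (hreach v u hr).not_gt hu
  refine ⟨fun h => ?_, fun ⟨hμ, hrep⟩ => ⟨hμ, fun C hC => ?_, fun v _ => ?_⟩⟩
  · have := h.isProbabilityMeasure
    exact ⟨this, M.represents_iff_hasCondLaw.2 fun v => h.hasCondLaw_of_notMem
      (fun v u hu => hlt u v hu) M.measurable_liftKernel
      (fun s hs => M.pa_subset_nd_of_mem hs) (M.notMem_nd v)⟩
  · rw [Set.compl_univ, cylinderEvents, iSup_emptyset] at hC
    obtain rfl | rfl := MeasurableSpace.measurableSet_bot_iff.1 hC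
    · simp only [measure_empty]
    · simp only [measure_univ]
  · exact (M.represents_iff_hasCondLaw.1 hrep v).mono (cylinderEvents_mono (hnd v))

theorem nonempty_X (v : V) : Nonempty (M.X v) := by
  induction v using M.wellFounded.wellFounded.induction with
  | _ v ih =>
    have := M.markov v
    exact nonempty_of_isProbabilityMeasure
      (M.K v fun u => Classical.choice (ih u.1 u.2))

end MTBN

theorem theorem5_general {V : Type*} (M : MTBN V) :
    ∃! μ : Measure (∀ v, M.X v), IsProbabilityMeasure μ ∧ M.Represents μ := by
  obtain ⟨_, _, hlt⟩ := M.wellFounded.exists_wellFoundedLT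
  have hpast : ∀ v, Measurable[cylinderEvents (Set.Iio v)] (M.liftKernel v) := fun v =>
    (M.measurable_liftKernel v).mono (cylinderEvents_mono fun u hu => hlt u v hu) le_rfl
  have x : ∀ v, M.X v := fun v => Classical.choice (M.nonempty_X v)
  simpa only [M.isResampling_univ_iff_represents hlt] using
    existsUnique_isResampling hpast Set.univ x

theorem theorem5 (M : BLOG.Model) (h : WellFoundedDigraph M.Edge) :
    ∃! μ : Measure (∀ v : BLOG.BRV M.toVocab, v.Space),
      IsProbabilityMeasure μ ∧ (M.toMTBN h).Represents μ :=
  theorem5_general (M.toMTBN h)
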